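/- Let $(X,d)$ be a complete metric space with a Borel measure $\mu$, let $V$ be a real Banach space, and let $\Omega\subset X$ be a bounded domain (a bounded, nonempty, connected open set). Let $\mathcal H$ be a Borel measure that is $\sigma$-finite on $\partial\Omega$, and let $\theta>1$. Write $B(x,r)$ for the open ball with center $x$ and radius $r$, and $f_A=\mu(A)^{-1}\int_A f\,d\mu$ for the mean of $f$ over $A$. Assume that $\Omega$ is weakly $\theta$-admissible, that is: (a) (doubling) there is $C_d\ge 1$ with $0<\mu(B(x,2r)\cap\Omega)\le C_d\,\mu(B(x,r)\cap\Omega)<\infty$ for all $x\in\overline\Omega$ and $r>0$; (b) (upper codimension-$\theta$ regularity) there is $C$ with $\mathcal H(B(x,r)\cap\partial\Omega)\le C\, r^{-\theta}\mu(B(x,r)\cap\Omega)$ for all $x\in\partial\Omega$ and $0<r<2\operatorname{diam}\Omega$; (c) (local $\theta$-Poincaré inequality) there are $C>0$ and $\lambda\ge1$ such that, for all $x\in\Omega$ and $r>0$, $$\frac1{\mu(B(x,r)\cap\Omega)}\int_{B(x,r)\cap\Omega}|u-u_{B(x,r)\cap\Omega}|\,d\mu\le C r\Big(\frac1{\mu(B(x,\lambda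 r)\cap\Omega)}\int_{B(x,\lambda r)\cap\Omega}g^\theta\,d\mu\Big)^{1/\theta}$$ for every real function $u\in L^1_{\rm loc}(\Omega)$ that is integrable on $B(x,r)\cap\Omega$ and every upper gradient $g$ of $u$ in $\Omega$. Here a Borel function $g\colon\Omega\to[0,\infty]$ is an upper gradient of a (real- or $V$-valued) function $u$ on $\Omega$ if $|u(\gamma(b))-u(\gamma(a))|\le\int_\gamma g\,ds$ for every rectifiable curve $\gamma\colon[a,b]\to\Omega$. Assume moreover that $\overline\Omega$ is compact and that $\Omega$ is a John domain: there are $c_J\in(0,1]$ and $a\in\Omega$ such that every $x\in\Omega$ can be joined to $a$ by a rectifiable curve $\gamma\colon[0,\ell]\to\Omega$ parametrized by arc length with $\gamma(0)=x$, $\gamma(\ell)=a$ and $\operatorname{dist}(\gamma(t),X\setminus\Omega)\ge c_J t$ for all $t\in[0,\ell]$. Let $\omega\colon(0,\infty)\to[1,\infty)$ be non-increasing, and set $\rho(x)=\omega(\operatorname{dist}(x,\partial\Omega))$ for $x\in\Omega$. Let $N^{1,\theta}(\Omega,V,\rho\,d\mu)$ be the space of all $u\in L^\theta(\Omega,V,\rho\,d\mu)$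 that have an upper gradient in $L^\theta(\Omega,\rho\,d\mu)$, with norm $\|u\|_{L^\theta(\Omega,V,\rho\,d\mu)}+\inf_g\|g\|_{L^\theta(\Omega,\rho\,d\mu)}$, where the infimum is over all $\theta$-weak upper gradients $g$ of $u$ (Borel functions for which the upper gradient inequality holds for all rectifiable curves in $\Omega$ outside a family of zero $\theta$-modulus with respect to $\rho\,d\mu$, the modulus of a family $\Gamma$ being $\inf_h\int_\Omega h^\theta\rho\,d\mu$ over all Borel $h\colon\Omega\to[0,\infty]$ with $\int_\gamma h\,ds\ge1$ for all $\gamma\in\Gamma$), and where functions at distance zero are identified. If $$\int_0^1 t^{-1}\,\omega(t)^{-1/(\theta-1)}\,dt<\infty,$$ then every $u\in N^{1,\theta}(\Omega,V,\rho\,d\mu)$ has a trace $Tu$ on $\partial\Omega$, that is, for $\mathcal H$-almost every $z\in\partial\Omega$ there is $Tu(z)\in V$ with $$\lim_{r\to0^+}\frac1{\mu(B(z,r)\cap\Omega)}\int_{B(z,r)\cap\Omega}|u-Tu(z)|\,d\mu=0,$$ and $T\colon N^{1,\theta}(\Omega,V,\rho\,d\mu)\to L^\theta(\partial\Omega,V,d\mathcal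 H)$ is a bounded linear operator. -/

import Mathlib

open MeasureTheory Set Filter Topology
open scoped ENNReal NNReal

set_option linter.unusedSectionVars false

noncomputable section

namespace BorderlineTrace

/-! ### Rectifiable curves, line integrals, modulus -/

/-- A rectifiable curve `γ : [a, b] → Ω`: continuous and of finite length. (Values of `toFun`
outside `[a, b]` play no role.) -/
structure RectifiableCurve {X : Type*} [MetricSpace X] (Ω : Set X) where
  toFun : ℝ → X
  a : ℝ
  b : ℝ
  le : a ≤ b
  continuousOn : ContinuousOn toFun (Icc a b)
  rectifiable : eVariationOn toFun (Icc a b) ≠ ∞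
  mapsTo : MapsTo toFun (Icc a b) Ω

variable {X : Type*} [MetricSpace X]

/-- The length of a rectifiable curve. -/
def RectifiableCurve.length {Ω : Set X} (γ : RectifiableCurve Ω) : ℝ :=
  (eVariationOn γ.toFun (Icc γ.a γ.b)).toReal

/-- The arc-length parametrization of a rectifiable curve, to be used on `[0, γ.length]`. -/
def RectifiableCurve.arcLength {Ω : Set X} (γ : RectifiableCurve Ω) : ℝ → X :=
  naturalParameterization γ.toFun (Icc γ.a γ.b) γ.a

/-- The line integral `∫_γ g ds`, computed in the arc-length parametrization. -/
def RectifiableCurve.lineIntegral {Ω : Set X} (γ : RectifiableCurve Ω) (g : X → ℝ≥0∞) : ℝ≥0∞ :=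
  ∫⁻ t in Icc 0 γ.length, g (γ.arcLength t)

/-- The defining inequality of an upper gradient along one curve. -/
def UpperGradientIneq {V : Type*} [NormedAddCommGroup V] {Ω : Set X} (u : X → V) (g : X → ℝ≥0∞)
    (γ : RectifiableCurve Ω) : Prop :=
  ‖u (γ.toFun γ.b) - u (γ.toFun γ.a)‖ₑ ≤ γ.lineIntegral g

variable [MeasurableSpace X]

/-- `g` is an upper gradient of `u` in `Ω`. -/
def IsUpperGradient {V : Type*} [NormedAddCommGroup V] (Ω : Set X) (u : X → V)
    (g : X → ℝ≥0∞) : Prop :=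
  Measurable g ∧ ∀ γ : RectifiableCurve Ω, UpperGradientIneq u g γ

/-- The `p`-modulus, with respect to the measure `m` on `Ω`, of a family of rectifiable curves
in `Ω`. -/
def modulus (p : ℝ) (Ω : Set X) (m : Measure X) (Γ : Set (RectifiableCurve Ω)) : ℝ≥0∞ :=
  ⨅ (h : X → ℝ≥0∞) (_ : Measurable h) (_ : ∀ γ ∈ Γ, 1 ≤ γ.lineIntegral h),
    ∫⁻ x in Ω, h x ^ p ∂m

/-- `g` is a `p`-weak upper gradient of `u` in `Ω`: the upper gradient inequality holds for
all rectifiable curves in `Ω` outside a family of zero `p`-modulus. -/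
def IsWeakUpperGradient {V : Type*} [NormedAddCommGroup V] (p : ℝ) (Ω : Set X) (m : Measure X)
    (u : X → V) (g : X → ℝ≥0∞) : Prop :=
  Measurable g ∧ modulus p Ω m {γ | ¬ UpperGradientIneq u g γ} = 0

/-! ### The Sobolev space `N^{1,p}(Ω, V, m)` -/

/-- The `L^p(Ω, m)` norm of a nonnegative function. -/
def gradNorm (p : ℝ) (Ω : Set X) (m : Measure X) (g : X → ℝ≥0∞) : ℝ≥0∞ :=
  (∫⁻ x in Ω, g x ^ p ∂m) ^ (1 / p)

/-- The Dirichlet seminorm: the infimum of the `L^p` norms of all `p`-weak upper gradients. -/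
def dirichletSeminorm {V : Type*} [NormedAddCommGroup V] (p : ℝ) (Ω : Set X) (m : Measure X)
    (u : X → V) : ℝ≥0∞ :=
  ⨅ (g : X → ℝ≥0∞) (_ : IsWeakUpperGradient p Ω m u g), gradNorm p Ω m g

section helpers

variable {V : Type*} [NormedAddCommGroup V] [NormedSpace ℝ V] {p : ℝ} {Ω : Set X} {m : Measure X}
  {u v : X → V} {g h : X → ℝ≥0∞}

lemma UpperGradientIneq.add {γ : RectifiableCurve Ω} (hu : UpperGradientIneq u g γ)
    (hv : UpperGradientIneq v h γ) : UpperGradientIneq (u + v) (g + h) γ := by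
  unfold UpperGradientIneq at *
  have e : (u + v) (γ.toFun γ.b) - (u + v) (γ.toFun γ.a) =
      (u (γ.toFun γ.b) - u (γ.toFun γ.a)) + (v (γ.toFun γ.b) - v (γ.toFun γ.a)) := by
    simp only [Pi.add_apply]; abel
  rw [e]
  exact (enorm_add_le _ _).trans ((add_le_add hu hv).trans (le_lintegral_add _ _))

lemma UpperGradientIneq.smul {γ : RectifiableCurve Ω} (c : ℝ) (hu : UpperGradientIneq u g γ) :
    UpperGradientIneq (c • u) (fun x => ‖c‖ₑ * g x) γ := by
  unfold UpperGradientIneq at *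
  rw [Pi.smul_apply, Pi.smul_apply, ← smul_sub, enorm_smul]
  exact (mul_le_mul_right hu _).trans (lintegral_const_mul_le _ _)

lemma modulus_mono {Γ Γ' : Set (RectifiableCurve Ω)} (hΓ : Γ ⊆ Γ') :
    modulus p Ω m Γ ≤ modulus p Ω m Γ' := by
  refine le_iInf fun h => le_iInf fun hm => le_iInf fun ha => ?_
  exact iInf_le_of_le h (iInf_le_of_le hm (iInf_le_of_le (fun γ hγ => ha γ (hΓ hγ)) le_rfl))

lemma modulus_union {Γ Γ' : Set (RectifiableCurve Ω)} :
    modulus p Ω m (Γ ∪ Γ') ≤ modulus p Ω m Γ + modulus p Ω m Γ' := by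
  simp only [modulus, ENNReal.iInf_add, ENNReal.add_iInf]
  refine le_iInf fun k => le_iInf fun km => le_iInf fun ka => le_iInf fun h =>
    le_iInf fun hm => le_iInf fun ha => ?_
  refine iInf_le_of_le (fun x => max (h x) (k x)) (iInf_le_of_le (hm.max km)
    (iInf_le_of_le ?_ ?_))
  · rintro γ (hγ | hγ)
    · exact (ha γ hγ).trans (lintegral_mono fun t => le_max_left _ _)
    · exact (ka γ hγ).trans (lintegral_mono fun t => le_max_right _ _)
  · rw [← lintegral_add_left (hm.pow_const p)]
    refine lintegral_mono fun x => ?_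
    rcases le_total (h x) (k x) with hx | hx
    · simp [max_eq_right hx]
    · simp [max_eq_left hx]

lemma IsUpperGradient.isWeak (hg : IsUpperGradient Ω u g) (hp : 0 < p) :
    IsWeakUpperGradient p Ω m u g := by
  refine ⟨hg.1, le_antisymm ?_ bot_le⟩
  refine iInf_le_of_le 0 (iInf_le_of_le measurable_zero (iInf_le_of_le ?_ ?_))
  · intro γ hγ
    exact absurd (hg.2 γ) hγ
  · simp [hp]

lemma IsWeakUpperGradient.add (hg : IsWeakUpperGradient p Ω m u g)
    (hh : IsWeakUpperGradient p Ω m v h) : IsWeakUpperGradient p Ω m (u + v) (g + h) := by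
  refine ⟨hg.1.add hh.1, le_antisymm ?_ bot_le⟩
  refine (modulus_mono (Γ' := {γ | ¬ UpperGradientIneq u g γ} ∪
    {γ | ¬ UpperGradientIneq v h γ}) ?_).trans (modulus_union.trans ?_)
  · intro γ hγ
    by_contra hcon
    simp only [mem_union, mem_ofPred_eq, not_or, not_not] at hcon
    exact hγ (hcon.1.add hcon.2)
  · rw [hg.2, hh.2, add_zero]

lemma IsWeakUpperGradient.smul (c : ℝ) (hg : IsWeakUpperGradient p Ω m u g) :
    IsWeakUpperGradient p Ω m (c • u) (fun x => ‖c‖ₑ * g x) := by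
  refine ⟨hg.1.const_mul _, le_antisymm ?_ bot_le⟩
  refine (modulus_mono ?_).trans hg.2.le
  intro γ hγ hcon
  exact hγ (hcon.smul c)

lemma gradNorm_add (hp : 1 ≤ p) (hg : Measurable g) (hh : Measurable h) :
    gradNorm p Ω m (g + h) ≤ gradNorm p Ω m g + gradNorm p Ω m h :=
  ENNReal.lintegral_Lp_add_le hg.aemeasurable hh.aemeasurable hp

lemma gradNorm_mul (hp : 0 < p) (c : ℝ≥0∞) (hg : Measurable g) :
    gradNorm p Ω m (fun x => c * g x) = c * gradNorm p Ω m g := by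
  unfold gradNorm
  simp_rw [ENNReal.mul_rpow_of_nonneg _ _ hp.le]
  rw [lintegral_const_mul _ (hg.pow_const p), ENNReal.mul_rpow_of_nonneg _ _ (by positivity),
    ← ENNReal.rpow_mul, mul_one_div_cancel hp.ne', ENNReal.rpow_one]

lemma dirichletSeminorm_add (hp : 1 ≤ p) :
    dirichletSeminorm p Ω m (u + v) ≤ dirichletSeminorm p Ω m u + dirichletSeminorm p Ω m v := by
  conv_rhs => simp only [dirichletSeminorm, ENNReal.iInf_add, ENNReal.add_iInf]
  refine le_iInf fun h => le_iInf fun hh => le_iInf fun g => le_iInf fun hg => ?_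
  exact iInf_le_of_le _ (iInf_le_of_le (hg.add hh) (gradNorm_add hp hg.1 hh.1))

lemma dirichletSeminorm_zero (hp : 0 < p) : dirichletSeminorm p Ω m (0 : X → V) = 0 := by
  have h0 : IsUpperGradient Ω (0 : X → V) 0 :=
    ⟨measurable_zero, fun γ => by simp [UpperGradientIneq]⟩
  refine le_antisymm ?_ bot_le
  refine iInf_le_of_le 0 (iInf_le_of_le (h0.isWeak hp) ?_)
  simp [gradNorm, hp]

lemma dirichletSeminorm_smul (hp : 0 < p) (c : ℝ) :
    dirichletSeminorm p Ω m (c • u) ≤ ‖c‖ₑ * dirichletSeminorm p Ω m u := by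
  rcases eq_or_ne c 0 with rfl | hc
  · simp [dirichletSeminorm_zero hp]
  have hc' : ‖c‖ₑ ≠ 0 := by simpa using hc
  conv_rhs => simp only [dirichletSeminorm, ENNReal.mul_iInf_of_ne hc' enorm_ne_top]
  refine le_iInf fun g => le_iInf fun hg => ?_
  exact iInf_le_of_le _ (iInf_le_of_le (hg.smul c) (gradNorm_mul hp _ hg.1).le)

lemma one_le_of_fact [hp : Fact (1 ≤ ENNReal.ofReal p)] : 1 ≤ p :=
  ENNReal.one_le_ofReal.1 hp.out

end helpers

instance fact_one_le_ofReal {p : ℝ} [hp : Fact (1 < p)] : Fact (1 ≤ ENNReal.ofReal p) :=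
  ⟨ENNReal.one_le_ofReal.2 hp.out.le⟩

/-- The functions on `Ω` lying in `L^p(Ω, V, m)` that have an upper gradient in `L^p(Ω, m)`.
(A function on `Ω` is represented by a function on `X`; values off `Ω` play no role, and are
identified below.) -/
def preSobolevSubmodule {X : Type*} [MetricSpace X] [MeasurableSpace X] (p : ℝ)
    [Fact (1 ≤ ENNReal.ofReal p)] (Ω : Set X) (V : Type*) [NormedAddCommGroup V]
    [NormedSpace ℝ V] (m : Measure X) : Submodule ℝ (X → V) where
  carrier := {u | MemLp u (ENNReal.ofReal p) (m.restrict Ω) ∧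
    ∃ g : X → ℝ≥0∞, IsUpperGradient Ω u g ∧ gradNorm p Ω m g < ∞}
  zero_mem' := by
    have hp : 1 ≤ p := one_le_of_fact
    refine ⟨MemLp.zero, 0, ⟨measurable_zero, fun γ => by simp [UpperGradientIneq]⟩, ?_⟩
    have : 0 < p := by linarith
    simp [gradNorm, this]
  add_mem' := by
    rintro u v ⟨hu, g, hg, hg'⟩ ⟨hv, h, hh, hh'⟩
    exact ⟨hu.add hv, g + h, ⟨hg.1.add hh.1, fun γ => (hg.2 γ).add (hh.2 γ)⟩,
      (gradNorm_add one_le_of_fact hg.1 hh.1).trans_lt (ENNReal.add_lt_top.2 ⟨hg', hh'⟩)⟩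
  smul_mem' := by
    rintro c u ⟨hu, g, hg, hg'⟩
    have hp : 1 ≤ p := one_le_of_fact
    refine ⟨hu.const_smul c, _, ⟨hg.1.const_mul _, fun γ => (hg.2 γ).smul c⟩, ?_⟩
    rw [gradNorm_mul (by linarith) _ hg.1]
    exact ENNReal.mul_lt_top enorm_lt_top hg'

/-- The seminormed space `Ñ^{1,p}(Ω, V, m)`. -/
def PreSobolev {X : Type*} [MetricSpace X] [MeasurableSpace X] (p : ℝ)
    [Fact (1 ≤ ENNReal.ofReal p)] (Ω : Set X) (V : Type*) [NormedAddCommGroup V]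
    [NormedSpace ℝ V] (m : Measure X) : Type _ :=
  preSobolevSubmodule p Ω V m

namespace PreSobolev

variable {p : ℝ} [Fact (1 ≤ ENNReal.ofReal p)] {Ω : Set X} {V : Type*} [NormedAddCommGroup V]
  [NormedSpace ℝ V] {m : Measure X}

instance : AddCommGroup (PreSobolev p Ω V m) :=
  inferInstanceAs (AddCommGroup (preSobolevSubmodule p Ω V m))

instance : Module ℝ (PreSobolev p Ω V m) :=
  inferInstanceAs (Module ℝ (preSobolevSubmodule p Ω V m))

/-- The underlying function of an element of `Ñ^{1,p}(Ω, V, m)`. -/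
def fn (u : PreSobolev p Ω V m) : X → V := u.1

lemma fn_add (u v : PreSobolev p Ω V m) : (u + v).fn = u.fn + v.fn := rfl
lemma fn_smul (c : ℝ) (u : PreSobolev p Ω V m) : (c • u).fn = c • u.fn := rfl
lemma fn_zero : (0 : PreSobolev p Ω V m).fn = 0 := rfl

lemma memLp (u : PreSobolev p Ω V m) : MemLp u.fn (ENNReal.ofReal p) (m.restrict Ω) := u.2.1

lemma dirichlet_ne_top (u : PreSobolev p Ω V m) : dirichletSeminorm p Ω m u.fn ≠ ∞ := by
  obtain ⟨_, g, hg, hg'⟩ := u.2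
  have hp : 1 ≤ p := one_le_of_fact
  have hle : dirichletSeminorm p Ω m u.fn ≤ gradNorm p Ω m g :=
    iInf_le_of_le g (iInf_le_of_le (hg.isWeak (by linarith)) le_rfl)
  exact (hle.trans_lt hg').ne

/-- The norm `‖u‖_{L^p(Ω, V, m)} + inf_g ‖g‖_{L^p(Ω, m)}`. -/
instance : Norm (PreSobolev p Ω V m) :=
  ⟨fun u => (eLpNorm u.fn (ENNReal.ofReal p) (m.restrict Ω)).toReal +
    (dirichletSeminorm p Ω m u.fn).toReal⟩

lemma norm_def (u : PreSobolev p Ω V m) :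
    ‖u‖ = (eLpNorm u.fn (ENNReal.ofReal p) (m.restrict Ω)).toReal +
      (dirichletSeminorm p Ω m u.fn).toReal := rfl

lemma norm_smul_le' (c : ℝ) (u : PreSobolev p Ω V m) : ‖c • u‖ ≤ ‖c‖ * ‖u‖ := by
  have hp : 1 ≤ p := one_le_of_fact
  rw [norm_def, norm_def, fn_smul, eLpNorm_const_smul, ENNReal.toReal_mul, toReal_enorm, mul_add]
  gcongr
  rw [← toReal_enorm c, ← ENNReal.toReal_mul]
  exact ENNReal.toReal_mono (ENNReal.mul_ne_top enorm_ne_top u.dirichlet_ne_top)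
    (dirichletSeminorm_smul (by linarith) c)

lemma norm_add_le' (u v : PreSobolev p Ω V m) : ‖u + v‖ ≤ ‖u‖ + ‖v‖ := by
  have hp : 1 ≤ p := one_le_of_fact
  have h1 : (eLpNorm (u + v).fn (ENNReal.ofReal p) (m.restrict Ω)).toReal ≤
      (eLpNorm u.fn (ENNReal.ofReal p) (m.restrict Ω)).toReal +
      (eLpNorm v.fn (ENNReal.ofReal p) (m.restrict Ω)).toReal := by
    rw [← ENNReal.toReal_add u.memLp.2.ne v.memLp.2.ne, fn_add]
    exact ENNReal.toReal_mono (ENNReal.add_ne_top.2 ⟨u.memLp.2.ne, v.memLp.2.ne⟩)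
      (eLpNorm_add_le u.memLp.1 v.memLp.1 Fact.out)
  have h2 : (dirichletSeminorm p Ω m (u + v).fn).toReal ≤
      (dirichletSeminorm p Ω m u.fn).toReal + (dirichletSeminorm p Ω m v.fn).toReal := by
    rw [← ENNReal.toReal_add u.dirichlet_ne_top v.dirichlet_ne_top, fn_add]
    exact ENNReal.toReal_mono (ENNReal.add_ne_top.2 ⟨u.dirichlet_ne_top, v.dirichlet_ne_top⟩)
      (dirichletSeminorm_add hp)
  rw [norm_def, norm_def, norm_def]
  linarith

instance : SeminormedAddCommGroup (PreSobolev p Ω V m) :=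
  SeminormedAddCommGroup.ofCore (𝕜 := ℝ)
    { norm_nonneg := fun u => add_nonneg ENNReal.toReal_nonneg ENNReal.toReal_nonneg
      norm_smul := fun c u => by
        refine le_antisymm (norm_smul_le' c u) ?_
        rcases eq_or_ne c 0 with rfl | hc
        · rw [norm_zero, zero_mul]
          exact add_nonneg ENNReal.toReal_nonneg ENNReal.toReal_nonneg
        · have h := norm_smul_le' c⁻¹ (c • u)
          rw [inv_smul_smul₀ hc, norm_inv] at h
          rwa [← le_inv_mul_iff₀ (norm_pos_iff.2 hc)]
      norm_triangle := norm_add_le' }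

instance : NormedSpace ℝ (PreSobolev p Ω V m) where
  norm_smul_le := norm_smul_le'

end PreSobolev

/-- The Sobolev space `N^{1,p}(Ω, V, m)`: the normed space obtained from `Ñ^{1,p}(Ω, V, m)` by
identifying functions at distance zero. -/
abbrev Sobolev {X : Type*} [MetricSpace X] [MeasurableSpace X] (p : ℝ)
    [Fact (1 ≤ ENNReal.ofReal p)] (Ω : Set X) (V : Type*) [NormedAddCommGroup V]
    [NormedSpace ℝ V] (m : Measure X) : Type _ :=
  SeparationQuotient (PreSobolev p Ω V m)

/-! ### Assumptions on the domain -/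

/-- A bounded domain: a bounded, nonempty, connected open set. -/
def IsBoundedDomain (Ω : Set X) : Prop :=
  IsOpen Ω ∧ IsConnected Ω ∧ Bornology.IsBounded Ω

/-- `μ` is a doubling measure on `Ω`. -/
def IsDoublingOn (μ : Measure X) (Ω : Set X) : Prop :=
  ∃ C : ℝ≥0, 1 ≤ C ∧ ∀ x ∈ closure Ω, ∀ r : ℝ, 0 < r →
    0 < μ (Metric.ball x (2 * r) ∩ Ω) ∧
    μ (Metric.ball x (2 * r) ∩ Ω) ≤ C * μ (Metric.ball x r ∩ Ω) ∧
    C * μ (Metric.ball x r ∩ Ω) < ∞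

/-- `H` is upper codimension-`θ` regular on `F` (with respect to `μ` on the bounded set `Ω`),
at all scales `0 < r < 2 diam Ω`. -/
def IsUpperCodimRegular (θ : ℝ) (μ H : Measure X) (Ω F : Set X) : Prop :=
  ∃ C : ℝ≥0, ∀ x ∈ F, ∀ r : ℝ, 0 < r → r < 2 * Metric.diam Ω →
    H (Metric.ball x r ∩ F) ≤ C * (μ (Metric.ball x r ∩ Ω) / ENNReal.ofReal (r ^ θ))

/-- `Ω` supports a local `q`-Poincaré inequality. -/
def SupportsLocalPoincare (q : ℝ) (μ : Measure X) (Ω : Set X) : Prop :=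
  ∃ C lam : ℝ, 0 < C ∧ 1 ≤ lam ∧ ∀ x ∈ Ω, ∀ r : ℝ, 0 < r →
    ∀ u : X → ℝ, LocallyIntegrableOn u Ω μ → IntegrableOn u (Metric.ball x r ∩ Ω) μ →
    ∀ g : X → ℝ≥0∞, IsUpperGradient Ω u g →
      ⨍⁻ y in Metric.ball x r ∩ Ω, ‖u y - ⨍ z in Metric.ball x r ∩ Ω, u z ∂μ‖ₑ ∂μ ≤
        ENNReal.ofReal (C * r) *
          (⨍⁻ y in Metric.ball x (lam * r) ∩ Ω, g y ^ q ∂μ) ^ (1 / q)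

/-- `Ω` is weakly `θ`-admissible (the borderline case in which the Poincaré exponent equals the
codimension `θ`), where `∂Ω` carries the measure `H`. -/
structure IsWeaklyAdmissible (θ : ℝ) (μ H : Measure X) (Ω : Set X) : Prop where
  doubling : IsDoublingOn μ Ω
  codim : IsUpperCodimRegular θ μ H Ω (frontier Ω)
  poincare : SupportsLocalPoincare θ μ Ω

/-- `Ω` satisfies the John condition for some John constant `c ∈ (0, 1]` and John center `a`.
(The distance to the complement is `∞` if the complement is empty.) -/
def IsJohn (Ω : Set X) : Prop :=
  ∃ c : ℝ, 0 < c ∧ c ≤ 1 ∧ ∃ a ∈ Ω, ∀ x ∈ Ω, ∃ (L : ℝ) (γ : ℝ → X), 0 ≤ L ∧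
    HasUnitSpeedOn γ (Icc 0 L) ∧ MapsTo γ (Icc 0 L) Ω ∧ γ 0 = x ∧ γ L = a ∧
    ∀ t ∈ Icc 0 L, ENNReal.ofReal (c * t) ≤ Metric.infEDist (γ t) Ωᶜ

/-- The weighted measure `ρ μ`, `ρ(x) = ω(dist(x, ∂Ω))`, to be used on `Ω`. -/
def weightedMeasure (ω : ℝ → ℝ) (μ : Measure X) (Ω : Set X) : Measure X :=
  μ.withDensity fun x => ENNReal.ofReal (ω (Metric.infDist x (frontier Ω)))

/-- `v` is the trace of `u` at the boundary point `z`. -/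
def IsTraceAt {V : Type*} [NormedAddCommGroup V] (μ : Measure X) (Ω : Set X) (u : X → V)
    (z : X) (v : V) : Prop :=
  Tendsto (fun r : ℝ => ⨍⁻ x in Metric.ball z r ∩ Ω, ‖u x - v‖ₑ ∂μ) (𝓝[>] 0) (𝓝 0)

end BorderlineTrace

end

namespace BorderlineTrace

open Metric

/-! Write ν for μ restricted to Ω and r_k = R(1-σ)^k. The John condition attaches to each boundary
point z, down to any prescribed height, a curve whose point y_k at height r_k is within 2r_k of z
and at distance at least c r_k from the complement of Ω. By Poincaré, the averages of u over B(y_k,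
σ r_k) and B(y_{k+1}, σ r_{k+1}) differ by at most the scaled energy of g on a ball of radius c
r_k/2. The weight there is at least ω(3r_k), so the jump is at most C ω(3r_k)^(-1/θ) E_k(z)^(1/θ),
where E_k(z) (`coneEnergy`) is the scaled weighted energy in the part of B(z, 3r_k) at distance at
least c r_k/2 from the complement.

Hölder's inequality with exponents θ/(θ-1) and θ splits the sum of the jumps
(`sum_mul_coneEnergy_le`). The weight factor Σ ω(3r_k)^(-1/(θ-1)) is finite by the integral
condition (`tsum_weight_lt_top`). The energy factor is finite almost everywhere: the layers have
bounded overlap, so Tonelli and codimension regularity give ∫ Σ E_k dH ≤ C ∫ g^θ ρ dμ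
(`exists_lintegral_coneEnergy_le`). This is what the John condition buys: with full balls about z, a
point would be counted at a number of scales that grows without bound near the boundary.

The trace is defined by balls centered at z. Passing from the chain to these balls costs
`ballEnergy`, which tends to zero almost everywhere: the finite measure g^θ ν does not charge ∂Ω,
hence has vanishing codimension-θ density there by a Vitali covering (`ae_tendsto_density_zero`). So
the averages at z are Cauchy, their limit is the trace, and the same estimates give the L^θ bound.

Two reductions precede this. The scalar Poincaré inequality passes to V-valued functions through
norming functionals and telescoping at Lebesgue points (`DoublingWith.exists_poincareOn_of_dual`),
and weak upper gradients are approximated in norm by upper gradients (`exists_lineIntegral_eq_top`).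
Linearity of the trace comes from its uniqueness. -/

lemma setLAverage_add {X : Type*} [MeasurableSpace X] {ν : Measure X} {f g : X → ℝ≥0∞}
    (hf : AEMeasurable f ν) (A : Set X) :
    ⨍⁻ x in A, (f x + g x) ∂ν = (⨍⁻ x in A, f x ∂ν) + ⨍⁻ x in A, g x ∂ν := by
  rw [setLAverage_eq, setLAverage_eq, setLAverage_eq, lintegral_add_left' hf.restrict,
    ENNReal.add_div]

/-! ### Doubling measures, measurability of ball masses, Tonelli for balls. -/

section Doubling

variable {X : Type*} [MetricSpace X] [MeasurableSpace X]

/-- `ν` is concentrated on `K` and doubling on balls centered in `K`, with constant `D`. -/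
structure DoublingWith (ν : Measure X) (K : Set X) (D : ℝ≥0) : Prop where
  one_le : 1 ≤ D
  ae_mem : ∀ᵐ x ∂ν, x ∈ K
  pos : ∀ x ∈ K, ∀ r : ℝ, 0 < r → 0 < ν (ball x r)
  le : ∀ x ∈ K, ∀ r : ℝ, 0 < r → ν (ball x (2 * r)) ≤ D * ν (ball x r)

variable {ν : Measure X} {K : Set X} {D : ℝ≥0}

lemma DoublingWith.le_pow (hν : DoublingWith ν K D) {x : X} (hx : x ∈ K) {r : ℝ} (hr : 0 < r)
    (n : ℕ) : ν (ball x (2 ^ n * r)) ≤ (D : ℝ≥0∞) ^ n * ν (ball x r) := by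
  induction n with
  | zero => simp
  | succ n ih =>
    calc ν (ball x (2 ^ (n + 1) * r)) = ν (ball x (2 * (2 ^ n * r))) := by ring_nf
      _ ≤ D * ν (ball x (2 ^ n * r)) := hν.le x hx _ (by positivity)
      _ ≤ D * ((D : ℝ≥0∞) ^ n * ν (ball x r)) := by gcongr
      _ = _ := by ring

/-- Iterated doubling. Allowing any subset of the large ball, rather than a concentric ball, makes
later comparisons of balls with different centers a matter of inclusion. -/
lemma DoublingWith.exists_scale (hν : DoublingWith ν K D) (M : ℝ) :
    ∃ E : ℝ≥0, 1 ≤ E ∧ ∀ x ∈ K, ∀ r : ℝ, 0 < r → ∀ A : Set X, A ⊆ ball x (M * r) →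
      ν A ≤ E * ν (ball x r) := by
  obtain ⟨n, hn⟩ := pow_unbounded_of_one_lt M (one_lt_two)
  refine ⟨D ^ n, one_le_pow₀ hν.one_le, fun x hx r hr A hA => ?_⟩
  calc ν A ≤ ν (ball x (2 ^ n * r)) :=
        measure_mono (hA.trans (ball_subset_ball (by gcongr)))
    _ ≤ _ := by simpa using hν.le_pow hx hr n

variable [BorelSpace X]

/-- The mass of an open ball is lower semicontinuous in the center, because the ball is the
increasing union of slightly smaller balls. -/
lemma measurable_measure_ball (ν : Measure X) (s : ℝ) :
    Measurable fun x => ν (ball x s) := by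
  refine measurable_of_Ioi fun a => IsOpen.measurableSet ?_
  rw [Metric.isOpen_iff]
  intro x hx
  have hU : ball x s = ⋃ n : ℕ, ball x (s - 1 / (n + 1)) := by
    ext y
    simp only [mem_ball, mem_iUnion]
    constructor
    · intro h
      obtain ⟨n, hn⟩ := exists_nat_one_div_lt (sub_pos.2 h)
      exact ⟨n, by linarith⟩
    · rintro ⟨n, hn⟩
      have : (0 : ℝ) < 1 / (n + 1) := by positivity
      linarith
  have hmono : Monotone fun n : ℕ => ball x (s - 1 / ((n : ℝ) + 1)) := by
    intro m n hmn
    refine ball_subset_ball (sub_le_sub_left ?_ _)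
    gcongr
  have hx' : a < ν (ball x s) := hx
  rw [hU, hmono.measure_iUnion] at hx'
  obtain ⟨n, hn⟩ := lt_iSup_iff.1 hx'
  refine ⟨1 / (n + 1), by positivity, fun y hy => ?_⟩
  refine lt_of_lt_of_le hn (measure_mono (ball_subset_ball' ?_))
  rw [mem_ball, dist_comm] at hy
  linarith

/-- Tonelli's theorem for balls, in a compact set (without separability of the whole space). -/
lemma lintegral_lintegral_ball_swap (hK : IsCompact K) (μ₁ μ₂ : Measure X) [IsFiniteMeasure μ₁]
    [IsFiniteMeasure μ₂] (h₁ : ∀ᵐ x ∂μ₁, x ∈ K) (h₂ : ∀ᵐ x ∂μ₂, x ∈ K) {f : X → ℝ≥0∞}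
    (hf : Measurable f) (s : ℝ) :
    ∫⁻ x, ∫⁻ y in ball x s, f y ∂μ₂ ∂μ₁ = ∫⁻ y, f y * μ₁ (ball y s) ∂μ₂ := by
  have hKm : MeasurableSet K := hK.isClosed.measurableSet
  have : CompactSpace K := isCompact_iff_compactSpace.1 hK
  have : SecondCountableTopology K := inferInstance
  -- Both measures are moved to the compact, hence second countable, space K: there the set of pairs
  -- at distance less than s is measurable for the product σ-algebra.
  have e₁ : μ₁ = (Measure.comap Subtype.val μ₁ : Measure K).map Subtype.val := by
    rw [map_comap_subtype_coe hKm, Measure.restrict_eq_self_of_ae_mem h₁]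
  have e₂ : μ₂ = (Measure.comap Subtype.val μ₂ : Measure K).map Subtype.val := by
    rw [map_comap_subtype_coe hKm, Measure.restrict_eq_self_of_ae_mem h₂]
  have me := MeasurableEmbedding.subtype_coe hKm
  have t₁ : IsFiniteMeasure (Measure.comap Subtype.val μ₁ : Measure K) :=
    ⟨by rw [me.comap_apply]; exact measure_lt_top _ _⟩
  have t₂ : IsFiniteMeasure (Measure.comap Subtype.val μ₂ : Measure K) :=
    ⟨by rw [me.comap_apply]; exact measure_lt_top _ _⟩
  generalize (Measure.comap Subtype.val μ₁ : Measure K) = m₁ at e₁ t₁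
  generalize (Measure.comap Subtype.val μ₂ : Measure K) = m₂ at e₂ t₂
  subst e₁ e₂
  have hS : MeasurableSet {p : K × K | dist (p.2 : X) p.1 < s} :=
    (isOpen_lt (by fun_prop) (by fun_prop)).measurableSet
  calc ∫⁻ x, ∫⁻ y in ball x s, f y ∂(m₂.map Subtype.val) ∂(m₁.map Subtype.val)
      = ∫⁻ x : K, ∫⁻ y : K,
          {p : K × K | dist (p.2 : X) p.1 < s}.indicator (fun p => f p.2) (x, y) ∂m₂ ∂m₁ := by
        rw [me.lintegral_map]
        refine lintegral_congr fun x => ?_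
        rw [← lintegral_indicator measurableSet_ball, me.lintegral_map]
        rfl
    _ = ∫⁻ y : K, ∫⁻ x : K,
          {p : K × K | dist (p.2 : X) p.1 < s}.indicator (fun p => f p.2) (x, y) ∂m₁ ∂m₂ := by
        refine lintegral_lintegral_swap (Measurable.aemeasurable ?_)
        exact (Measurable.indicator (by fun_prop) hS)
    _ = _ := by
        rw [me.lintegral_map]
        refine lintegral_congr fun y => ?_
        rw [← setLIntegral_const, ← lintegral_indicator measurableSet_ball, me.lintegral_map]
        refine lintegral_congr fun x => ?_
        simp only [indicator, mem_ball, mem_ofPred_eq]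
        rw [dist_comm]

lemma div_le_mul_div_of_le_mul {a b c M : ℝ≥0∞} (hb : b ≠ 0) (hb' : b ≠ ∞) (hc : c ≠ 0)
    (hc' : c ≠ ∞) (h : c ≤ M * b) : a / b ≤ M * (a / c) := by
  calc a / b ≤ a * (M / c) := by
        rw [div_eq_mul_inv]
        gcongr
        rw [ENNReal.le_div_iff_mul_le (Or.inl hc) (Or.inl hc')]
        calc b⁻¹ * c ≤ b⁻¹ * (M * b) := by gcongr
          _ = M * (b⁻¹ * b) := by ring
          _ = M := by rw [ENNReal.inv_mul_cancel hb hb', mul_one]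
    _ = _ := by rw [div_eq_mul_inv, div_eq_mul_inv]; ring

lemma laverage_le_mul_laverage [IsFiniteMeasure ν] {A B : Set X} (hAB : A ⊆ B) {M : ℝ≥0∞}
    (hM : ν B ≤ M * ν A) (hA : ν A ≠ 0) (f : X → ℝ≥0∞) :
    ⨍⁻ x in A, f x ∂ν ≤ M * ⨍⁻ x in B, f x ∂ν := by
  rw [setLAverage_eq, setLAverage_eq]
  have hB : ν B ≠ 0 := fun h => hA (measure_mono_null hAB h)
  calc (∫⁻ x in A, f x ∂ν) / ν A ≤ (∫⁻ x in B, f x ∂ν) / ν A := by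
        gcongr
    _ ≤ _ := div_le_mul_div_of_le_mul hA (measure_ne_top _ _) hB (measure_ne_top _ _) hM

end Doubling

/-! ### Elementary estimates for vector-valued averages. -/

section Averages

variable {X : Type*} [MeasurableSpace X] {ν : Measure X} [IsFiniteMeasure ν]
  {V : Type*} [NormedAddCommGroup V] [NormedSpace ℝ V] [CompleteSpace V] {u : X → V}

lemma enorm_average_le (A : Set X) (u : X → V) :
    ‖⨍ x in A, u x ∂ν‖ₑ ≤ ⨍⁻ x in A, ‖u x‖ₑ ∂ν := by
  rw [average_eq', laverage_eq']
  exact enorm_integral_le_lintegral_enorm _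

lemma average_sub_const {A : Set X} (hA : ν A ≠ 0) (hu : IntegrableOn u A ν) (c : V) :
    ⨍ x in A, (u x - c) ∂ν = (⨍ x in A, u x ∂ν) - c := by
  have h1 := setAverage_const hA (measure_ne_top ν A) c
  conv_rhs => rw [← h1]
  rw [setAverage_eq, setAverage_eq, setAverage_eq, integral_sub hu (integrable_const _), smul_sub]

lemma enorm_average_sub_le {A : Set X} (hA : ν A ≠ 0) (hu : IntegrableOn u A ν) (c : V) :
    ‖(⨍ x in A, u x ∂ν) - c‖ₑ ≤ ⨍⁻ x in A, ‖u x - c‖ₑ ∂ν := by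
  rw [← average_sub_const hA hu]
  exact enorm_average_le _ _

lemma laverage_enorm_sub_le {A : Set X} (hA : ν A ≠ 0) (hu : AEStronglyMeasurable u ν) (c d : V) :
    ⨍⁻ x in A, ‖u x - c‖ₑ ∂ν ≤ (⨍⁻ x in A, ‖u x - d‖ₑ ∂ν) + ‖d - c‖ₑ := by
  conv_rhs => rw [← setLAverage_const hA (measure_ne_top ν A) ‖d - c‖ₑ]
  rw [← setLAverage_add (f := fun x => ‖u x - d‖ₑ) (hu.sub aestronglyMeasurable_const).enorm]
  refine laverage_mono_ae (Eventually.of_forall fun x => ?_)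
  simpa using enorm_add_le (u x - d) (d - c)

/-- The mean is optimal up to a factor 2, so a Poincaré inequality may be proved with any convenient
constant. -/
lemma laverage_sub_average_le {A : Set X} (hA : ν A ≠ 0) (hu : Integrable u ν) (c : V) :
    ⨍⁻ x in A, ‖u x - ⨍ y in A, u y ∂ν‖ₑ ∂ν ≤ 2 * ⨍⁻ x in A, ‖u x - c‖ₑ ∂ν := by
  refine (laverage_enorm_sub_le hA hu.1 _ c).trans ?_
  rw [two_mul]
  gcongr
  rw [← enorm_neg, neg_sub]
  exact enorm_average_sub_le hA hu.integrableOn c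

end Averages

/-! ### Lebesgue points, and iterated averages over balls. -/

section Lebesgue

variable {X : Type*} [MetricSpace X] [MeasurableSpace X] [BorelSpace X] {ν : Measure X}
  [IsFiniteMeasure ν] {K : Set X} {D : ℝ≥0}
  {V : Type*} [NormedAddCommGroup V] {u : X → V}

/-- Lebesgue's differentiation theorem for a measure that is doubling on a compact set. -/
lemma DoublingWith.ae_tendsto_laverage (hν : DoublingWith ν K D) (hK : IsCompact K)
    (hu : Integrable u ν) :
    ∀ᵐ x ∂ν, Tendsto (fun r : ℝ => ⨍⁻ y in ball x r, ‖u y - u x‖ₑ ∂ν) (𝓝[>] 0) (𝓝 0) := by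
  have hKm : MeasurableSet K := hK.isClosed.measurableSet
  have : CompactSpace K := isCompact_iff_compactSpace.1 hK
  have me := MeasurableEmbedding.subtype_coe hKm
  obtain ⟨E, hE1, hE⟩ := hν.exists_scale 4
  have e : ν = (Measure.comap Subtype.val ν : Measure K).map Subtype.val := by
    rw [map_comap_subtype_coe hKm, Measure.restrict_eq_self_of_ae_mem hν.ae_mem]
  have t : IsFiniteMeasure (Measure.comap Subtype.val ν : Measure K) :=
    ⟨by rw [me.comap_apply]; exact measure_lt_top _ _⟩
  obtain ⟨m, hm⟩ : ∃ m : Measure K, m = Measure.comap Subtype.val ν := ⟨_, rfl⟩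
  rw [← hm] at e t
  have hball : ∀ (x : K) (r : ℝ), m (closedBall x r) = ν (closedBall (x : X) r) := by
    intro x r
    rw [e, me.map_apply]
    rfl
  have hav : ∀ (x : K) (r : ℝ) (f : X → ℝ≥0∞),
      ⨍⁻ y in closedBall x r, f y ∂m = ⨍⁻ y in closedBall (x : X) r, f y ∂ν := by
    intro x r f
    rw [setLAverage_eq, setLAverage_eq, hball]
    congr 1
    conv_rhs => rw [e, me.restrict_map, me.lintegral_map]
    rfl
  -- Uniform doubling is phrased with closed balls; the scale 4 absorbs the passage from the closed
  -- ball of radius 2r to an open one.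
  have hd : IsUnifLocDoublingMeasure m := by
    refine ⟨E, ?_⟩
    filter_upwards [self_mem_nhdsWithin] with r hr x
    have hr : 0 < r := hr
    rw [hball, hball]
    refine (hE x x.2 r hr _ (closedBall_subset_ball (by linarith))).trans ?_
    gcongr
    exact ball_subset_closedBall
  have hum : Integrable (fun x : K => u x) m := by
    have : Integrable u (m.map Subtype.val) := by rwa [← e]
    exact this.comp_measurable measurable_subtype_coe
  have hL := IsUnifLocDoublingMeasure.ae_tendsto_average_norm_sub m hum.locallyIntegrable 1
  have hL' : ∀ᵐ x ∂ν, x ∈ K → Tendsto (fun r : ℝ => ⨍⁻ y in ball x r, ‖u y - u x‖ₑ ∂ν)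
      (𝓝[>] 0) (𝓝 0) := by
    rw [e, me.ae_map_iff, ← e]
    filter_upwards [hL] with x hx _
    have h1 := hx (l := 𝓝[>] (0 : ℝ)) (fun _ => x) (fun r => r) tendsto_id (by
      filter_upwards [self_mem_nhdsWithin] with r hr
      simpa using (le_of_lt hr))
    have h2 : Tendsto (fun r : ℝ => ⨍⁻ y in closedBall (x : X) r, ‖u y - u x‖ₑ ∂ν)
        (𝓝[>] 0) (𝓝 0) := by
      have h3 := (ENNReal.continuous_ofReal.tendsto 0).comp h1
      simp only [ENNReal.ofReal_zero] at h3
      refine h3.congr fun r => ?_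
      simp only [Function.comp]
      rw [ofReal_setAverage, ← hav x r (fun y => ‖u y - u x‖ₑ)]
      · simp only [ofReal_norm]
        rw [setLAverage_eq]
      · exact ((hum.sub (integrable_const _)).norm).integrableOn
      · exact Eventually.of_forall fun _ => norm_nonneg _
    have h4 : Tendsto (fun r : ℝ => (E : ℝ≥0∞) * ⨍⁻ y in closedBall (x : X) r, ‖u y - u x‖ₑ ∂ν)
        (𝓝[>] 0) (𝓝 0) := by
      simpa using ENNReal.Tendsto.const_mul h2 (Or.inr ENNReal.coe_ne_top)
    refine tendsto_of_tendsto_of_tendsto_of_le_of_le' tendsto_const_nhds h4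
      (Eventually.of_forall fun _ => bot_le) ?_
    filter_upwards [self_mem_nhdsWithin] with r hr
    have hr : 0 < r := hr
    exact laverage_le_mul_laverage ball_subset_closedBall
      (hE x x.2 r hr _ (closedBall_subset_ball (by linarith))) (hν.pos x x.2 r hr).ne' _
  filter_upwards [hL', hν.ae_mem] with x h1 h2 using h1 h2

/-- The average is a quotient of masses of balls, the numerator for the measure with density f. -/
lemma measurable_laverage_ball (f : X → ℝ≥0∞) (s : ℝ) :
    Measurable fun x => ⨍⁻ y in ball x s, f y ∂ν := by
  simp_rw [setLAverage_eq, ← withDensity_apply f measurableSet_ball]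
  exact (measurable_measure_ball _ s).div (measurable_measure_ball _ s)

/-- Jensen's inequality for a concave power, read off from the monotonicity of L^p norms on a
probability space. -/
lemma laverage_rpow_le {f : X → ℝ≥0∞} (hf : AEMeasurable f ν) {A : Set X} (hA : ν A ≠ 0) {q : ℝ}
    (hq : 1 ≤ q) : ⨍⁻ x in A, f x ^ (1 / q) ∂ν ≤ (⨍⁻ x in A, f x ∂ν) ^ (1 / q) := by
  have hq0 : 0 < q := by linarith
  rw [setLAverage_eq', setLAverage_eq']
  have : IsProbabilityMeasure ((ν A)⁻¹ • ν.restrict A) := by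
    constructor
    simp [ENNReal.inv_mul_cancel hA (measure_ne_top _ _)]
  have h := eLpNorm'_le_eLpNorm'_of_exponent_le (f := f) (p := 1 / q) (q := 1) (by positivity)
    (by rw [div_le_one hq0]; exact hq) ((ν A)⁻¹ • ν.restrict A)
    (hf.restrict.smul_measure _).aestronglyMeasurable
  simp only [eLpNorm', enorm_eq_self, one_div, inv_inv, ENNReal.rpow_one, inv_one] at h
  simp only [one_div]
  have h' := ENNReal.rpow_le_rpow h (z := q⁻¹) (by positivity)
  rwa [← ENNReal.rpow_mul, mul_inv_cancel₀ hq0.ne', ENNReal.rpow_one] at h'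

/-- For y in B(x,s), doubling lets ν(B(y,s)) replace ν(B(x,s)) in the inner denominator. After
Tonelli this factor cancels the mass of the set of x that see y. -/
lemma DoublingWith.laverage_laverage_le (hν : DoublingWith ν K D) (hK : IsCompact K) {E : ℝ≥0}
    {z : X} {r s R : ℝ} (hz : z ∈ K) (hr : 0 < r) (hs : 0 < s) (hR : r + s ≤ R)
    (hE : ν (ball z R) ≤ E * ν (ball z r)) {f : X → ℝ≥0∞} (hf : Measurable f) :
    ⨍⁻ x in ball z r, ⨍⁻ y in ball x s, f y ∂ν ∂ν ≤ D * E * ⨍⁻ y in ball z R, f y ∂ν := by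
  set f' : X → ℝ≥0∞ := (ball z R).indicator f with hf'
  have hf'm : Measurable f' := hf.indicator measurableSet_ball
  have h1 : ∫⁻ x in ball z r, ⨍⁻ y in ball x s, f y ∂ν ∂ν ≤ D * ∫⁻ y in ball z R, f y ∂ν := by
    calc ∫⁻ x in ball z r, ⨍⁻ y in ball x s, f y ∂ν ∂ν
        ≤ ∫⁻ x in ball z r, ∫⁻ y in ball x s, D * f' y / ν (ball y s) ∂ν ∂ν := by
          refine lintegral_mono_ae ?_
          filter_upwards [ae_restrict_mem measurableSet_ball, ae_restrict_of_ae hν.ae_mem]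
            with x hx hxK
          rw [setLAverage_eq, ENNReal.div_eq_inv_mul, ← lintegral_const_mul _ hf]
          refine lintegral_mono_ae ?_
          filter_upwards [ae_restrict_mem measurableSet_ball, ae_restrict_of_ae hν.ae_mem]
            with y hy hyK
          have hyR : y ∈ ball z R := by
            simp only [mem_ball] at hx hy ⊢
            linarith [dist_triangle y x z]
          rw [hf', indicator_of_mem hyR, div_eq_mul_inv, mul_right_comm]
          gcongr
          have hD0 : (D : ℝ≥0∞) ≠ 0 := by
            have := zero_lt_one.trans_le hν.one_le
            exact_mod_cast this.ne'
          rw [← ENNReal.inv_le_inv, inv_inv,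
            ENNReal.mul_inv (Or.inl hD0) (Or.inl ENNReal.coe_ne_top), inv_inv,
            ← ENNReal.div_eq_inv_mul]
          refine ENNReal.div_le_of_le_mul' ?_
          refine (measure_mono ?_).trans (hν.le x hxK s hs)
          refine ball_subset_ball' ?_
          rw [mem_ball] at hy
          linarith
      _ ≤ ∫⁻ x, ∫⁻ y in ball x s, D * f' y / ν (ball y s) ∂ν ∂ν := setLIntegral_le_lintegral _ _
      _ = ∫⁻ y, D * f' y / ν (ball y s) * ν (ball y s) ∂ν :=
          lintegral_lintegral_ball_swap hK ν ν hν.ae_mem hν.ae_mem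
            ((hf'm.const_mul _).div (measurable_measure_ball _ s)) s
      _ ≤ ∫⁻ y, D * f' y ∂ν := lintegral_mono fun y => by
          rw [mul_comm]
          exact ENNReal.mul_div_le
      _ = D * ∫⁻ y in ball z R, f y ∂ν := by
          rw [lintegral_const_mul _ hf'm, hf', lintegral_indicator measurableSet_ball]
  have hA := (hν.pos z hz r hr).ne'
  have hB : ν (ball z R) ≠ 0 := (hν.pos z hz R (by linarith)).ne'
  calc ⨍⁻ x in ball z r, ⨍⁻ y in ball x s, f y ∂ν ∂ν
      ≤ (D * ∫⁻ y in ball z R, f y ∂ν) / ν (ball z r) := by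
        rw [setLAverage_eq]; gcongr
    _ ≤ E * ((D * ∫⁻ y in ball z R, f y ∂ν) / ν (ball z R)) :=
        div_le_mul_div_of_le_mul hA (measure_ne_top _ _) hB (measure_ne_top _ _) hE
    _ = _ := by
        rw [setLAverage_eq, div_eq_mul_inv, div_eq_mul_inv]
        ring

end Lebesgue

/-! ### From scalar to vector-valued Poincaré inequalities. -/

section Poincare

variable {X : Type*} [MetricSpace X] [MeasurableSpace X] [BorelSpace X] {ν : Measure X}
  [IsFiniteMeasure ν] {K S : Set X} {D C : ℝ≥0} {q lam : ℝ}
  {V : Type*} [NormedAddCommGroup V] [NormedSpace ℝ V] {u : X → V} {g : X → ℝ≥0∞}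

/-- The `(1, q)`-Poincaré inequality for the pair `(u, g)` on balls centered in `S`. -/
def PoincareOn (ν : Measure X) (S : Set X) (q : ℝ) (C : ℝ≥0) (lam : ℝ) (u : X → V)
    (g : X → ℝ≥0∞) : Prop :=
  ∀ x ∈ S, ∀ r : ℝ, 0 < r →
    ⨍⁻ y in ball x r, ‖u y - ⨍ z in ball x r, u z ∂ν‖ₑ ∂ν ≤
      C * ENNReal.ofReal r * (⨍⁻ y in ball x (lam * r), g y ^ q ∂ν) ^ (1 / q)

lemma map_average [CompleteSpace V] (φ : StrongDual ℝ V) (hu : Integrable u ν) (A : Set X) :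
    φ (⨍ x in A, u x ∂ν) = ⨍ x in A, φ (u x) ∂ν := by
  rw [setAverage_eq, setAverage_eq, map_smul, φ.integral_comp_comm hu.integrableOn]

/-- A functional norming the difference of the two averages reduces the claim to one scalar
function. A difference of averages is a single vector, so one functional suffices; the oscillation
itself would need a different one at each point. -/
lemma enorm_average_sub_average_le_of_dual [CompleteSpace V] (hu : Integrable u ν)
    (hP : ∀ φ : StrongDual ℝ V, ‖φ‖ ≤ 1 → PoincareOn ν S q C lam (fun x => φ (u x)) g)
    {x : X} (hx : x ∈ S) {r : ℝ} (hr : 0 < r) {A : Set X} (hA : A ⊆ ball x r) {M : ℝ≥0∞}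
    (hM : ν (ball x r) ≤ M * ν A) (hA0 : ν A ≠ 0) :
    ‖(⨍ y in A, u y ∂ν) - ⨍ y in ball x r, u y ∂ν‖ₑ ≤
      M * (C * ENNReal.ofReal r * (⨍⁻ y in ball x (lam * r), g y ^ q ∂ν) ^ (1 / q)) := by
  obtain ⟨φ, hφ, hφw⟩ := exists_dual_vector'' ℝ
    ((⨍ y in A, u y ∂ν) - ⨍ y in ball x r, u y ∂ν)
  have h1 : ‖(⨍ y in A, u y ∂ν) - ⨍ y in ball x r, u y ∂ν‖ₑ =
      ‖(⨍ y in A, φ (u y) ∂ν) - ⨍ y in ball x r, φ (u y) ∂ν‖ₑ := by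
    rw [← map_average φ hu, ← map_average φ hu, ← map_sub, hφw, RCLike.ofReal_real_eq_id, id,
      enorm_norm]
  rw [h1]
  refine (enorm_average_sub_le hA0 (φ.integrable_comp hu).integrableOn _).trans ?_
  refine (laverage_le_mul_laverage hA hM hA0 _).trans ?_
  gcongr
  exact hP φ hφ x hx r hr

/-- At a Lebesgue point the dyadic averages converge to u x, so the difference telescopes. -/
lemma enorm_sub_average_le_tsum [CompleteSpace V] (hu : Integrable u ν) {x : X}
    (hpos : ∀ r : ℝ, 0 < r → ν (ball x r) ≠ 0)
    (hL : Tendsto (fun r : ℝ => ⨍⁻ y in ball x r, ‖u y - u x‖ₑ ∂ν) (𝓝[>] 0) (𝓝 0)) {r : ℝ}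
    (hr : 0 < r) :
    ‖u x - ⨍ y in ball x r, u y ∂ν‖ₑ ≤ ∑' k : ℕ,
      ‖(⨍ y in ball x (r * (1 / 2) ^ (k + 1)), u y ∂ν) -
        ⨍ y in ball x (r * (1 / 2) ^ k), u y ∂ν‖ₑ := by
  set a : ℕ → V := fun k => ⨍ y in ball x (r * (1 / 2) ^ k), u y ∂ν with ha
  have hseq : Tendsto (fun k : ℕ => r * (1 / 2 : ℝ) ^ k) atTop (𝓝[>] 0) := by
    refine tendsto_nhdsWithin_iff.2 ⟨?_, Eventually.of_forall fun k => ?_⟩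
    · simpa using (tendsto_pow_atTop_nhds_zero_of_lt_one (r := (1 / 2 : ℝ)) (by norm_num)
        (by norm_num)).const_mul r
    · exact mem_Ioi.2 (by positivity)
  have hlim : Tendsto a atTop (𝓝 (u x)) := by
    rw [tendsto_iff_edist_tendsto_0]
    refine tendsto_of_tendsto_of_tendsto_of_le_of_le tendsto_const_nhds (hL.comp hseq)
      (fun _ => bot_le) fun k => ?_
    rw [edist_eq_enorm_sub]
    exact enorm_average_sub_le (hpos _ (by positivity)) hu.integrableOn _
  have h := edist_le_tsum_of_edist_le_of_tendsto₀ (f := a)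
    (fun k => ‖a (k + 1) - a k‖ₑ) (fun k => by rw [edist_comm, edist_eq_enorm_sub]) hlim
  rw [edist_comm, edist_eq_enorm_sub] at h
  simpa [ha] using h

lemma tsum_ofReal_mul_half_pow {r : ℝ} (hr : 0 ≤ r) :
    ∑' k : ℕ, ENNReal.ofReal (r * (1 / 2) ^ k) = 2 * ENNReal.ofReal r := by
  simp_rw [ENNReal.ofReal_mul hr]
  rw [ENNReal.tsum_mul_left, ← ENNReal.ofReal_tsum_of_nonneg (fun _ => by positivity)
    summable_geometric_two, tsum_geometric_two, mul_comm]
  simp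

/-- A Poincaré inequality for all scalar functions `φ ∘ u` with `‖φ‖ ≤ 1` implies one for `u`. -/
lemma DoublingWith.exists_poincareOn_of_dual [CompleteSpace V] (hν : DoublingWith ν K D)
    (hK : IsCompact K) (hSK : S ⊆ K) (hS : ∀ᵐ x ∂ν, x ∈ S) (hq : 1 ≤ q) (hlam : 1 ≤ lam)
    (C : ℝ≥0) : ∃ C' : ℝ≥0, ∀ (u : X → V) (g : X → ℝ≥0∞), Integrable u ν → Measurable g →
      (∀ φ : StrongDual ℝ V, ‖φ‖ ≤ 1 → PoincareOn ν S q C lam (fun x => φ (u x)) g) →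
      PoincareOn ν K q C' (5 * lam) u g := by
  have hq0 : 0 < q := by linarith
  obtain ⟨E, hE1, hE⟩ := hν.exists_scale (6 * lam)
  obtain ⟨P, hP'⟩ : ∃ P : ℝ≥0, (P : ℝ≥0∞) = ((D * E : ℝ≥0) : ℝ≥0∞) ^ (1 / q) :=
    ⟨(D * E) ^ (1 / q), ENNReal.coe_rpow_of_nonneg _ (by positivity)⟩
  obtain ⟨Q, hQ'⟩ : ∃ Q : ℝ≥0, (Q : ℝ≥0∞) = (E : ℝ≥0∞) ^ (1 / q) :=
    ⟨E ^ (1 / q), ENNReal.coe_rpow_of_nonneg _ (by positivity)⟩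
  refine ⟨2 * (D * (C * (2 * 2)) * P + E * (C * 4) * Q), fun u g hu hg hP z hz r hr => ?_⟩
  have hpz := (hν.pos z hz r hr).ne'
  set I : ℝ≥0∞ := ⨍⁻ y in ball z (5 * lam * r), g y ^ q ∂ν with hI
  -- The scalar inequality is only available at centers in S, and z may lie outside; a nearby x₀ in
  -- S serves as the common center instead. The ball of radius 4λr about x₀ lies in B(z, 5λr),
  -- whence the dilation 5λ.
  obtain ⟨x₀, hx₀, hx₀S⟩ : ∃ x ∈ ball z r, x ∈ S := by
    have h1 : ∃ᵐ x ∂ν, x ∈ ball z r := frequently_ae_mem_iff.2 hpz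
    exact (h1.and_eventually hS).exists
  have hx₀' : dist x₀ z < r := hx₀
  set c : V := ⨍ y in ball x₀ (4 * r), u y ∂ν with hc
  have hlr : r ≤ lam * r := by nlinarith
  have hT : (⨍⁻ y in ball x₀ (lam * (4 * r)), g y ^ q ∂ν) ^ (1 / q) ≤ Q * I ^ (1 / q) := by
    rw [hQ', ← ENNReal.mul_rpow_of_nonneg _ _ (by positivity)]
    refine ENNReal.rpow_le_rpow ?_ (by positivity)
    refine laverage_le_mul_laverage (ball_subset_ball' (by nlinarith)) ?_
      (hν.pos x₀ (hSK hx₀S) _ (by positivity)).ne' _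
    refine hE x₀ (hSK hx₀S) _ (by positivity) _ (ball_subset_ball' ?_)
    rw [dist_comm]
    nlinarith
  set Φ : ℕ → X → ℝ≥0∞ := fun k x => ⨍⁻ y in ball x (lam * (2 * r * (1 / 2) ^ k)), g y ^ q ∂ν
    with hΦ
  have hΦm : ∀ k, Measurable (Φ k) := fun k => measurable_laverage_ball _ _
  -- Telescope from the Lebesgue point x up to B(x, 2r), then make one jump to B(x₀, 4r).
  have hpt : ∀ᵐ x ∂(ν.restrict (ball z r)), ‖u x - c‖ₑ ≤
      (∑' k : ℕ, D * (C * ENNReal.ofReal (2 * r * (1 / 2) ^ k) * Φ k x ^ (1 / q))) +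
        E * (C * ENNReal.ofReal (4 * r) * (Q * I ^ (1 / q))) := by
    filter_upwards [ae_restrict_mem measurableSet_ball, ae_restrict_of_ae hS,
      ae_restrict_of_ae (hν.ae_tendsto_laverage hK hu)] with x hx hxS hxL
    have hx' : dist x z < r := hx
    have hxK := hSK hxS
    have hxx₀ : dist x x₀ < 2 * r := by linarith [dist_triangle_right x x₀ z]
    have hpos : ∀ r : ℝ, 0 < r → ν (ball x r) ≠ 0 := fun r hr => (hν.pos x hxK r hr).ne'
    have e1 : u x - c = (u x - ⨍ y in ball x (2 * r), u y ∂ν) +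
        ((⨍ y in ball x (2 * r), u y ∂ν) - c) := by abel
    rw [e1]
    refine (enorm_add_le _ _).trans (add_le_add ?_ ?_)
    · refine (enorm_sub_average_le_tsum hu hpos hxL (by positivity)).trans ?_
      refine ENNReal.tsum_le_tsum fun k => ?_
      refine enorm_average_sub_average_le_of_dual hu hP hxS (by positivity) ?_ ?_
        (hpos _ (by positivity))
      · refine ball_subset_ball ?_
        rw [pow_succ]
        have : 0 < 2 * r * (1 / 2 : ℝ) ^ k := by positivity
        linarith
      · have := hν.le x hxK (2 * r * (1 / 2) ^ (k + 1)) (by positivity)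
        rwa [pow_succ, show 2 * (2 * r * ((1 / 2 : ℝ) ^ k * (1 / 2))) = 2 * r * (1 / 2) ^ k by
          ring] at this
    · refine (enorm_average_sub_average_le_of_dual hu hP hx₀S (r := 4 * r) (M := E) (by positivity)
        (ball_subset_ball' (by linarith)) ?_ (hpos _ (by positivity))).trans ?_
      · refine hE x hxK (2 * r) (by positivity) _ (ball_subset_ball' ?_)
        rw [dist_comm]
        nlinarith
      · gcongr
  -- This bound is uniform in k, so the series over scales is summed by the geometric factors r
  -- 2^(-k) alone.
  have hΦav : ∀ k, ⨍⁻ x in ball z r, Φ k x ^ (1 / q) ∂ν ≤ P * I ^ (1 / q) := by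
    intro k
    refine (laverage_rpow_le (hΦm k).aemeasurable hpz hq).trans ?_
    rw [hP', ← ENNReal.mul_rpow_of_nonneg _ _ (by positivity)]
    refine ENNReal.rpow_le_rpow ?_ (by positivity)
    rw [ENNReal.coe_mul]
    have hk : (1 / 2 : ℝ) ^ k ≤ 1 := pow_le_one₀ (by norm_num) (by norm_num)
    have hk' : r * (1 / 2 : ℝ) ^ k ≤ r := by nlinarith
    refine hν.laverage_laverage_le hK hz hr (by positivity) ?_ ?_ (hg.pow_const q)
    · nlinarith
    · exact hE z hz r hr _ (ball_subset_ball (by nlinarith))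
  have hmain : ⨍⁻ x in ball z r, ‖u x - c‖ₑ ∂ν ≤
      D * (C * (2 * 2)) * P * ENNReal.ofReal r * I ^ (1 / q) +
      E * (C * 4) * Q * ENNReal.ofReal r * I ^ (1 / q) := by
    refine (laverage_mono_ae hpt).trans ?_
    rw [setLAverage_add (Measurable.aemeasurable (Measurable.tsum fun k =>
        (((hΦm k).pow_const _).const_mul _).const_mul _)),
      setLAverage_const hpz (measure_ne_top _ _)]
    refine add_le_add ?_ (le_of_eq ?_)
    · rw [setLAverage_eq', lintegral_tsum fun k => Measurable.aemeasurable
        ((((hΦm k).pow_const _).const_mul _).const_mul _)]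
      calc ∑' k : ℕ, ∫⁻ x, D * (C * ENNReal.ofReal (2 * r * (1 / 2) ^ k) * Φ k x ^ (1 / q))
              ∂((ν (ball z r))⁻¹ • ν.restrict (ball z r))
          ≤ ∑' k : ℕ, D * (C * ENNReal.ofReal (2 * r * (1 / 2) ^ k)) * (P * I ^ (1 / q)) := by
            refine ENNReal.tsum_le_tsum fun k => ?_
            simp_rw [← mul_assoc]
            rw [lintegral_const_mul _ ((hΦm k).pow_const _), ← setLAverage_eq', mul_assoc _ (P : ℝ≥0∞)]
            gcongr
            exact hΦav k
        _ = _ := by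
            rw [ENNReal.tsum_mul_right, ENNReal.tsum_mul_left, ENNReal.tsum_mul_left,
              tsum_ofReal_mul_half_pow (by positivity), ENNReal.ofReal_mul (by norm_num)]
            simp only [ENNReal.ofReal_ofNat]
            ring
    · rw [ENNReal.ofReal_mul (by norm_num)]
      simp only [ENNReal.ofReal_ofNat]
      ring
  refine (laverage_sub_average_le hpz hu c).trans ?_
  calc 2 * ⨍⁻ x in ball z r, ‖u x - c‖ₑ ∂ν ≤ 2 * (
      D * (C * (2 * 2)) * P * ENNReal.ofReal r * I ^ (1 / q) +
      E * (C * 4) * Q * ENNReal.ofReal r * I ^ (1 / q)) := by gcongr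
    _ = _ := by push_cast; ring

end Poincare

/-! ### Vanishing codimension-θ densities on the boundary. -/

section Density

variable {X : Type*} [MetricSpace X] [MeasurableSpace X] [BorelSpace X] {ν H τ : Measure X}
  {K F : Set X} {D Ch : ℝ≥0} {θ R₁ : ℝ}

/-- `H` is upper codimension-`θ` regular on `F` at scales below `R₁`, with constant `Ch`. -/
def CodimWith (ν H : Measure X) (F : Set X) (θ : ℝ) (Ch : ℝ≥0) (R₁ : ℝ) : Prop :=
  ∀ z ∈ F, ∀ r : ℝ, 0 < r → r < R₁ → H (ball z r) ≤ Ch * (ν (ball z r) / ENNReal.ofReal (r ^ θ))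

/-- Vitali covering: at a bad point there are small radii r at which codimension regularity bounds
H(B(z, 6Mr)) by a multiple of τ(B(z, Mr)). Choosing these τ-balls disjoint bounds H of the bad set
by a multiple of τ of a thin neighborhood of F, which tends to τ(F) = 0. -/
lemma measure_frequently_lt_eq_zero [IsFiniteMeasure ν] [IsFiniteMeasure τ]
    (hν : DoublingWith ν K D) (hF : IsClosed F) (hFK : F ⊆ K) (hH : CodimWith ν H F θ Ch R₁)
    (hR₁ : 0 < R₁) (hθ : 0 ≤ θ) (hτ : τ F = 0) {M : ℝ} (hM : 1 ≤ M) {a : ℝ≥0∞} (ha : a ≠ 0)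
    (ha' : a ≠ ∞) :
    H {z | z ∈ F ∧ ∃ᶠ r in 𝓝[>] (0 : ℝ),
      a * ν (ball z r) < ENNReal.ofReal (r ^ θ) * τ (ball z (M * r))} = 0 := by
  set S := {z | z ∈ F ∧ ∃ᶠ r in 𝓝[>] (0 : ℝ),
      a * ν (ball z r) < ENNReal.ofReal (r ^ θ) * τ (ball z (M * r))} with hS
  -- The Vitali enlargements are closed balls of radius 5Mr, contained in open balls of radius 6Mr.
  obtain ⟨E, hE1, hE⟩ := hν.exists_scale (6 * M)
  have key : ∀ η : ℝ, 0 < η → 6 * M * η < R₁ →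
      H S ≤ Ch * E * a⁻¹ * τ (cthickening (M * η) F) := by
    intro η hη hηR
    have hex : ∀ z ∈ S, ∃ r : ℝ, 0 < r ∧ r < η ∧
        a * ν (ball z r) < ENNReal.ofReal (r ^ θ) * τ (ball z (M * r)) := by
      intro z hz
      obtain ⟨r, h1, h2⟩ := (hz.2.and_eventually (Ioo_mem_nhdsGT hη)).exists
      exact ⟨r, h2.1, h2.2, h1⟩
    choose! ρ hρ0 hρη hρ using hex
    obtain ⟨w, hwS, hdisj, hcov⟩ :=
      Vitali.exists_disjoint_subfamily_covering_enlargement_closedBall S (fun z => z)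
        (fun z => M * ρ z) (M * η) (fun z hz => by nlinarith [hρη z hz]) 5 (by norm_num)
    have hdisj' : Pairwise (Function.onFun Disjoint fun z : w => ball (z : X) (M * ρ z)) := by
      intro z z' hzz'
      exact (hdisj z.2 z'.2 (fun h => hzz' (Subtype.ext h))).mono ball_subset_closedBall
        ball_subset_closedBall
    -- Countability comes from the finiteness of τ: the selected balls are disjoint, and the bad
    -- inequality gives each of them positive mass. No separability of X is needed.
    have hwc : Countable w := by
      have h := Measure.countable_meas_pos_of_disjoint_iUnion (μ := τ)
        (fun z : w => measurableSet_ball (x := (z : X)) (ε := M * ρ z)) hdisj'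
      have h' : {z : w | 0 < τ (ball (z : X) (M * ρ z))} = univ := by
        refine eq_univ_of_forall fun z => ?_
        have := hρ z (hwS z.2)
        rw [mem_ofPred_eq, pos_iff_ne_zero]
        intro h0
        rw [h0, mul_zero] at this
        exact not_lt_bot this
      rw [h'] at h
      exact countable_univ_iff.1 h
    have hterm : ∀ z : w, H (closedBall (z : X) (5 * (M * ρ z))) ≤
        Ch * E * a⁻¹ * τ (ball (z : X) (M * ρ z)) := by
      intro z
      have hzS := hwS z.2
      have h0 := hρ0 z hzS
      have h1 := hρη z hzS
      have h2 := hρ z hzS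
      have hzF : (z : X) ∈ F := hzS.1
      have hMρ : 0 < M * ρ z := by positivity
      have hr0 : ENNReal.ofReal (ρ z ^ θ) ≠ 0 := by
        rw [Ne, ENNReal.ofReal_eq_zero, not_le]; positivity
      calc H (closedBall (z : X) (5 * (M * ρ z))) ≤ H (ball (z : X) (6 * M * ρ z)) :=
            measure_mono (closedBall_subset_ball (by nlinarith))
        _ ≤ Ch * (ν (ball (z : X) (6 * M * ρ z)) / ENNReal.ofReal ((6 * M * ρ z) ^ θ)) :=
            hH z hzF _ (by positivity) (by nlinarith)
        _ ≤ Ch * ((E * ν (ball (z : X) (ρ z))) / ENNReal.ofReal (ρ z ^ θ)) := by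
            gcongr
            · exact hE z (hFK hzF) _ h0 _ Subset.rfl
            · nlinarith
        _ ≤ Ch * ((E * (a⁻¹ * (ENNReal.ofReal (ρ z ^ θ) * τ (ball (z : X) (M * ρ z)))))
              / ENNReal.ofReal (ρ z ^ θ)) := by
            gcongr
            rw [← ENNReal.mul_le_iff_le_inv ha ha']
            exact h2.le
        _ = Ch * E * a⁻¹ * τ (ball (z : X) (M * ρ z)) *
              (ENNReal.ofReal (ρ z ^ θ) * (ENNReal.ofReal (ρ z ^ θ))⁻¹) := by
            rw [div_eq_mul_inv]; ring
        _ = _ := by rw [ENNReal.mul_inv_cancel hr0 ENNReal.ofReal_ne_top, mul_one]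
    calc H S ≤ H (⋃ z : w, closedBall (z : X) (5 * (M * ρ z))) := by
          refine measure_mono fun x hx => ?_
          obtain ⟨b, hb, hxb⟩ := hcov x hx
          refine mem_iUnion.2 ⟨⟨b, hb⟩, hxb ?_⟩
          have := hρ0 x hx
          exact mem_closedBall_self (by positivity)
      _ ≤ ∑' z : w, H (closedBall (z : X) (5 * (M * ρ z))) := measure_iUnion_le _
      _ ≤ ∑' z : w, Ch * E * a⁻¹ * τ (ball (z : X) (M * ρ z)) := ENNReal.tsum_le_tsum hterm
      _ = Ch * E * a⁻¹ * τ (⋃ z : w, ball (z : X) (M * ρ z)) := by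
          rw [ENNReal.tsum_mul_left, measure_iUnion hdisj' fun _ => measurableSet_ball]
      _ ≤ _ := by
          gcongr
          refine iUnion_subset fun z => ?_
          have hzS := hwS z.2
          refine Subset.trans (fun y hy => ?_) (thickening_subset_cthickening _ _)
          refine mem_thickening_iff.2 ⟨z, hzS.1, ?_⟩
          rw [mem_ball] at hy
          nlinarith [hρη z hzS]
  have hlim : Tendsto (fun η : ℝ => Ch * E * a⁻¹ * τ (cthickening (M * η) F)) (𝓝[>] 0) (𝓝 0) := by
    have h1 : Tendsto (fun η : ℝ => M * η) (𝓝[>] 0) (𝓝 0) := by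
      have : Tendsto (fun η : ℝ => M * η) (𝓝 0) (𝓝 (M * 0)) := tendsto_id.const_mul M
      rw [mul_zero] at this
      exact this.mono_left nhdsWithin_le_nhds
    have h2 := (tendsto_measure_cthickening_of_isClosed (μ := τ)
      ⟨1, one_pos, measure_ne_top _ _⟩ hF).comp h1
    rw [hτ] at h2
    simpa using ENNReal.Tendsto.const_mul h2 (Or.inr (ENNReal.mul_ne_top
      (ENNReal.mul_ne_top ENNReal.coe_ne_top ENNReal.coe_ne_top) (ENNReal.inv_ne_top.2 ha)))
  refine le_antisymm (ge_of_tendsto hlim ?_) bot_le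
  have hpos : 0 < R₁ / (6 * M) := by positivity
  filter_upwards [Ioo_mem_nhdsGT hpos] with η hη
  refine key η hη.1 ?_
  have := (lt_div_iff₀ (by positivity : 0 < 6 * M)).1 hη.2
  linarith

/-- A finite measure that does not charge `F` has vanishing codimension-`θ` density at almost
every point of `F`. -/
lemma ae_tendsto_density_zero [IsFiniteMeasure ν] [IsFiniteMeasure τ]
    (hν : DoublingWith ν K D) (hF : IsClosed F) (hFK : F ⊆ K) (hH : CodimWith ν H F θ Ch R₁)
    (hHF : ∀ᵐ z ∂H, z ∈ F) (hR₁ : 0 < R₁) (hθ : 0 ≤ θ) (hτ : τ F = 0) {M : ℝ} (hM : 1 ≤ M) :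
    ∀ᵐ z ∂H, Tendsto (fun r : ℝ => ENNReal.ofReal (r ^ θ) * τ (ball z (M * r)) / ν (ball z r))
      (𝓝[>] 0) (𝓝 0) := by
  -- A countable family of thresholds, so that the exceptional sets can be united.
  have h : ∀ n : ℕ, ∀ᵐ z ∂H, ¬ (z ∈ F ∧ ∃ᶠ r in 𝓝[>] (0 : ℝ),
      ((n : ℝ≥0∞) + 1)⁻¹ * ν (ball z r) < ENNReal.ofReal (r ^ θ) * τ (ball z (M * r))) := by
    intro n
    rw [ae_iff]
    simp only [not_not]
    exact measure_frequently_lt_eq_zero hν hF hFK hH hR₁ hθ hτ hM (by simp) (by simp)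
  filter_upwards [ae_all_iff.2 h, hHF] with z hz hzF
  rw [ENNReal.tendsto_nhds_zero]
  intro ε hε
  obtain ⟨n, hn⟩ := ENNReal.exists_inv_nat_lt hε.ne'
  have h1 := hz n
  simp only [hzF, true_and, not_frequently, not_lt] at h1
  filter_upwards [h1, self_mem_nhdsWithin] with r hr hr0
  have hr0 : 0 < r := hr0
  refine ENNReal.div_le_of_le_mul (hr.trans ?_)
  gcongr
  refine le_trans ?_ hn.le
  gcongr
  exact le_self_add

end Density

/-! ### John curves, bounded overlap of layers, and the weight series. -/

section John

variable {X : Type*} [MetricSpace X] [MeasurableSpace X] {Ω : Set X}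

/-- In a John domain, points at height `t` above a boundary point can be chosen along a curve. -/
lemma IsJohn.exists_chain (hJ : IsJohn Ω) (hΩ : IsOpen Ω) (hne : (frontier Ω).Nonempty) :
    ∃ c R : ℝ, 0 < c ∧ c ≤ 1 ∧ 0 < R ∧ (∀ z ∈ frontier Ω, ∃ a ∈ Ω, 4 * R ≤ dist a z) ∧
      ∀ z ∈ frontier Ω, ∀ s : ℝ, 0 < s → s ≤ R → ∃ y : ℝ → X,
        (∀ t ∈ Icc s R, y t ∈ Ω ∧ dist (y t) z ≤ 2 * t ∧ c * t ≤ infDist (y t) Ωᶜ) ∧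
        ∀ t ∈ Icc s R, ∀ t' ∈ Icc s R, dist (y t) (y t') ≤ |t - t'| := by
  obtain ⟨c, hc0, hc1, a, ha, hJ⟩ := hJ
  have hfr : frontier Ω ⊆ Ωᶜ := fun z hz hzΩ => hΩ.inter_frontier_eq.le ⟨hzΩ, hz⟩
  have hcne : (Ωᶜ).Nonempty := hne.mono hfr
  have hd : 0 < infDist a Ωᶜ :=
    (hΩ.isClosed_compl.notMem_iff_infDist_pos hcne).1 (by simpa using ha)
  refine ⟨c, infDist a Ωᶜ / 4, hc0, hc1, by positivity, fun z hz => ⟨a, ha, ?_⟩, ?_⟩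
  · linarith [infDist_le_dist_of_mem (x := a) (hfr hz)]
  intro z hz s hs hsR
  -- Starting within s of z gives dist(γ t, z) ≤ t + s ≤ 2t once t ≥ s.
  obtain ⟨x, hx, hxz⟩ := Metric.mem_closure_iff.1 (frontier_subset_closure hz) s hs
  obtain ⟨L, γ, hL, hγ, hγΩ, hγ0, hγL, hγd⟩ := hJ x hx
  have hlip : ∀ t ∈ Icc 0 L, ∀ t' ∈ Icc 0 L, dist (γ t) (γ t') ≤ |t - t'| := by
    have hle : ∀ t ∈ Icc 0 L, ∀ t' ∈ Icc 0 L, t ≤ t' → dist (γ t) (γ t') ≤ t' - t := by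
      intro t ht t' ht' htt'
      have h1 := hγ ht ht'
      have h2 := eVariationOn.edist_le γ (s := Icc 0 L ∩ Icc t t') ⟨ht, left_mem_Icc.2 htt'⟩
        ⟨ht', right_mem_Icc.2 htt'⟩
      rw [h1, edist_dist] at h2
      have h3 := (ENNReal.ofReal_le_ofReal_iff (by simp; linarith)).1 h2
      simpa using h3
    intro t ht t' ht'
    rcases le_total t t' with h | h
    · rw [abs_sub_comm, abs_of_nonneg (sub_nonneg.2 h)]
      exact hle t ht t' ht' h
    · rw [dist_comm, abs_of_nonneg (sub_nonneg.2 h)]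
      exact hle t' ht' t ht h
  -- With R a quarter of the distance from a to the complement, dist(a, z) ≥ 4R and dist(x, z) < R,
  -- so the curve is long enough to reach height R.
  have hRL : infDist a Ωᶜ / 4 ≤ L := by
    have h1 := hlip 0 (left_mem_Icc.2 hL) L (right_mem_Icc.2 hL)
    rw [hγ0, hγL, zero_sub, abs_neg, abs_of_nonneg hL] at h1
    have h2 := infDist_le_dist_of_mem (x := a) (hfr hz)
    have h3 := dist_triangle a x z
    rw [dist_comm z x] at hxz
    rw [dist_comm] at h1
    linarith
  have hsub : Icc s (infDist a Ωᶜ / 4) ⊆ Icc 0 L := Icc_subset_Icc hs.le hRL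
  refine ⟨γ, fun t ht => ⟨hγΩ (hsub ht), ?_, ?_⟩, fun t ht t' ht' =>
    hlip t (hsub ht) t' (hsub ht')⟩
  · have h1 := hlip t (hsub ht) 0 (left_mem_Icc.2 hL)
    rw [hγ0, sub_zero, abs_of_nonneg (hsub ht).1] at h1
    rw [dist_comm z x] at hxz
    linarith [dist_triangle (γ t) x z, ht.1]
  · have h1 := hγd t (hsub ht)
    rw [infDist, ← ENNReal.ofReal_le_iff_le_toReal (infEDist_ne_top hcne)]
    exact h1

/-- Bounded overlap: the condition confines R p^k to an interval whose endpoints have ratio 6/c, and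
N steps with p^N < c/6 leave it. -/
lemma tsum_indicator_geometric_le {c p : ℝ} (hc : 0 < c) (hp0 : 0 < p) (hp1 : p < 1) {R : ℝ}
    (hR : 0 < R) : ∃ N : ℕ, ∀ d : ℝ,
      ∑' k : ℕ, (if c / 2 * (R * p ^ k) ≤ d ∧ d < 3 * (R * p ^ k) then (1 : ℝ≥0∞) else 0) ≤ N := by
  obtain ⟨N, hN⟩ := exists_pow_lt_of_lt_one (by positivity : 0 < c / 6) hp1
  refine ⟨N, fun d => ?_⟩
  by_cases hex : ∃ k : ℕ, c / 2 * (R * p ^ k) ≤ d ∧ d < 3 * (R * p ^ k)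
  · classical
    set k₀ := Nat.find hex
    have h0 := Nat.find_spec hex
    have hsub : ∀ k ∉ Finset.Ico k₀ (k₀ + N),
        (if c / 2 * (R * p ^ k) ≤ d ∧ d < 3 * (R * p ^ k) then (1 : ℝ≥0∞) else 0) = 0 := by
      intro k hk
      rw [if_neg]
      intro hk'
      have h1 : k₀ ≤ k := Nat.find_min' hex hk'
      have h2 : k₀ + N ≤ k := by simpa [h1] using hk
      have h3 : p ^ k ≤ p ^ (k₀ + N) := pow_le_pow_of_le_one hp0.le hp1.le h2
      rw [pow_add] at h3
      have h4 : p ^ k₀ * p ^ N ≤ p ^ k₀ * (c / 6) := by gcongr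
      have h5 : R * p ^ k ≤ R * (p ^ k₀ * (c / 6)) := by gcongr; linarith
      have h6 : c / 2 * (R * p ^ k₀) ≤ d := h0.1
      nlinarith [hk'.2]
    rw [tsum_eq_sum hsub]
    calc _ ≤ ∑ k ∈ Finset.Ico k₀ (k₀ + N), (1 : ℝ≥0∞) :=
          Finset.sum_le_sum fun k _ => by split_ifs <;> simp
      _ = N := by simp
  · push Not at hex
    have : ∀ k : ℕ, (if c / 2 * (R * p ^ k) ≤ d ∧ d < 3 * (R * p ^ k) then (1 : ℝ≥0∞) else 0) = 0 :=
      fun k => if_neg fun h => absurd h.2 (not_lt.2 (hex k h.1))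
    simp [this]

/-- The Dini-type integral condition controls the weight along a geometric sequence of radii. -/
lemma tsum_weight_lt_top {ω : ℝ → ℝ} (hω : AntitoneOn ω (Ioi 0)) (hω1 : ∀ t, 0 < t → 1 ≤ ω t)
    {α : ℝ} (hα : 0 ≤ α)
    (hint : ∫⁻ t in Ioo (0 : ℝ) 1, ENNReal.ofReal (t⁻¹ * ω t ^ (-α)) < ∞) {p R : ℝ} (hp0 : 0 < p)
    (hp1 : p < 1) (hR : 0 < R) (hR1 : R ≤ 1) :
    ∑' k : ℕ, ENNReal.ofReal (ω (R * p ^ k) ^ (-α)) < ∞ := by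
  have hrk : ∀ k : ℕ, 0 < R * p ^ k := fun k => by positivity
  have hstep : ∀ k : ℕ, R * p ^ (k + 1) = p * (R * p ^ k) := fun k => by rw [pow_succ]; ring
  have hanti : Antitone fun k : ℕ => R * p ^ k := by
    intro k l hkl
    exact mul_le_mul_of_nonneg_left (pow_le_pow_of_le_one hp0.le hp1.le hkl) hR.le
  have hdisj : Pairwise (Function.onFun Disjoint fun k : ℕ =>
      Ioo (R * p ^ (k + 1)) (R * p ^ k)) := by
    have hlt : ∀ k l : ℕ, k < l → Disjoint (Ioo (R * p ^ (k + 1)) (R * p ^ k))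
        (Ioo (R * p ^ (l + 1)) (R * p ^ l)) := by
      intro k l hkl
      rw [Set.disjoint_left]
      intro t ht ht'
      have := hanti (Nat.succ_le_of_lt hkl)
      simp only [Nat.succ_eq_add_one] at this
      linarith [ht.1, ht'.2]
    intro k l hkl
    rcases lt_or_gt_of_ne hkl with h | h
    · exact hlt k l h
    · exact (hlt l k h).symm
  -- On this interval t⁻¹ is at least (R p^k)⁻¹ and ω is at most its value at the left endpoint; the
  -- length is (1-p) R p^k.
  have hbound : ∀ k : ℕ, ENNReal.ofReal (1 - p) * ENNReal.ofReal (ω (R * p ^ (k + 1)) ^ (-α)) ≤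
      ∫⁻ t in Ioo (R * p ^ (k + 1)) (R * p ^ k), ENNReal.ofReal (t⁻¹ * ω t ^ (-α)) := by
    intro k
    calc ENNReal.ofReal (1 - p) * ENNReal.ofReal (ω (R * p ^ (k + 1)) ^ (-α))
        = ∫⁻ _ in Ioo (R * p ^ (k + 1)) (R * p ^ k),
            ENNReal.ofReal ((R * p ^ k)⁻¹ * ω (R * p ^ (k + 1)) ^ (-α)) := by
          rw [setLIntegral_const, Real.volume_Ioo, ← ENNReal.ofReal_mul (by linarith),
            ← ENNReal.ofReal_mul (mul_nonneg (inv_nonneg.2 (hrk k).le)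
              (Real.rpow_nonneg (zero_le_one.trans (hω1 _ (hrk _))) _))]
          congr 1
          have := (hrk k).ne'
          rw [hstep]
          field_simp
      _ ≤ _ := by
          refine setLIntegral_mono' measurableSet_Ioo fun t ht => ENNReal.ofReal_le_ofReal ?_
          have ht0 : 0 < t := (hrk _).trans ht.1
          have h1 := hω (mem_Ioi.2 (hrk (k + 1))) (mem_Ioi.2 ht0) ht.1.le
          have h2 := hω1 t ht0
          refine mul_le_mul (inv_anti₀ ht0 ht.2.le)
            (Real.rpow_le_rpow_of_nonpos (by linarith) h1 (by linarith)) ?_ (by positivity)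
          exact Real.rpow_nonneg (zero_le_one.trans (hω1 _ (hrk _))) _
  have hsum : ENNReal.ofReal (1 - p) * ∑' k : ℕ, ENNReal.ofReal (ω (R * p ^ (k + 1)) ^ (-α)) < ∞ := by
    rw [← ENNReal.tsum_mul_left]
    refine ((ENNReal.tsum_le_tsum hbound).trans ?_).trans_lt hint
    rw [← lintegral_iUnion (fun _ => measurableSet_Ioo) hdisj]
    refine lintegral_mono_set (iUnion_subset fun k t ht => ⟨(hrk _).trans ht.1, ?_⟩)
    refine ht.2.trans_le ?_
    have := hanti (Nat.zero_le k)
    simp only [pow_zero, mul_one] at this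
    linarith
  have h1p : ENNReal.ofReal (1 - p) ≠ 0 := by
    rw [Ne, ENNReal.ofReal_eq_zero]; linarith
  -- The integral controls the terms from index 1 on, as each interval yields the value at its left
  -- endpoint.
  rw [tsum_eq_zero_add' ENNReal.summable]
  refine ENNReal.add_lt_top.2 ⟨ENNReal.ofReal_lt_top, ?_⟩
  by_contra h
  rw [not_lt, top_le_iff] at h
  rw [h, ENNReal.mul_top h1p] at hsum
  exact lt_irrefl _ hsum

end John

/-! ### Energies near a boundary point and the cost of one step along a chain. -/

section Chains

variable {X : Type*} [MetricSpace X] [MeasurableSpace X] [BorelSpace X] {ν H τ : Measure X}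
  {K F G : Set X} {D Ch C : ℝ≥0} {θ R₁ R c lam : ℝ}
  {V : Type*} [NormedAddCommGroup V] [NormedSpace ℝ V] [CompleteSpace V]

lemma PoincareOn.average_sub_average_le [IsFiniteMeasure ν] {u : X → V} {g : X → ℝ≥0∞}
    (hP : PoincareOn ν K θ C lam u g) (hu : Integrable u ν) {x : X} (hx : x ∈ K) {r : ℝ}
    (hr : 0 < r) {A : Set X} (hA : A ⊆ ball x r) {M : ℝ≥0∞} (hM : ν (ball x r) ≤ M * ν A)
    (hA0 : ν A ≠ 0) :
    ⨍⁻ y in A, ‖u y - ⨍ z in ball x r, u z ∂ν‖ₑ ∂ν ≤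
      M * (C * ENNReal.ofReal r * (⨍⁻ y in ball x (lam * r), g y ^ θ ∂ν) ^ (1 / θ)) ∧
    ‖(⨍ y in A, u y ∂ν) - ⨍ y in ball x r, u y ∂ν‖ₑ ≤
      M * (C * ENNReal.ofReal r * (⨍⁻ y in ball x (lam * r), g y ^ θ ∂ν) ^ (1 / θ)) := by
  have h := (laverage_le_mul_laverage hA hM hA0
    (fun y => ‖u y - ⨍ z in ball x r, u z ∂ν‖ₑ)).trans (mul_le_mul_right (hP x hx r hr) M)
  exact ⟨h, (enorm_average_sub_le hA0 hu.integrableOn _).trans h⟩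

lemma enorm_sub_le_add (a b d : V) : ‖a - b‖ₑ ≤ ‖a - d‖ₑ + ‖b - d‖ₑ := by
  rw [← edist_eq_enorm_sub, ← edist_eq_enorm_sub, ← edist_eq_enorm_sub]
  exact edist_triangle_right _ _ _

/-- The scaled energy of `g` near `z` at scale `t`. -/
noncomputable def ballEnergy (ν : Measure X) (θ lam : ℝ) (g : X → ℝ≥0∞) (t : ℝ) (z : X) : ℝ≥0∞ :=
  ENNReal.ofReal t * (⨍⁻ y in ball z (lam * (3 * t)), g y ^ θ ∂ν) ^ (1 / θ)

/-- Both B(z,t) and B(y,σt) sit in B(z,3t) with comparable mass, so Poincaré on that ball compares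
both averages with a third one. The same ball explains the factor 3 in `ballEnergy`. -/
lemma exists_average_comparison [IsFiniteMeasure ν] (hν : DoublingWith ν K D) (C : ℝ≥0) {σ : ℝ}
    (hσ : 0 < σ) (hσ1 : σ ≤ 1) (lam : ℝ) :
    ∃ C' : ℝ≥0, ∀ (u : X → V) (g : X → ℝ≥0∞), Integrable u ν → PoincareOn ν K θ C lam u g →
      ∀ z ∈ K, ∀ t : ℝ, 0 < t →
        ⨍⁻ y in ball z t, ‖u y - ⨍ x in ball z t, u x ∂ν‖ₑ ∂ν ≤ C' * ballEnergy ν θ lam g t z ∧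
        ∀ y ∈ K, dist y z ≤ 2 * t →
          ‖(⨍ x in ball y (σ * t), u x ∂ν) - ⨍ x in ball z t, u x ∂ν‖ₑ ≤
            C' * ballEnergy ν θ lam g t z := by
  obtain ⟨E, hE1, hE⟩ := hν.exists_scale 3
  -- B(z,3t) lies in B(y,5t), which is 5/σ times larger than B(y,σt).
  obtain ⟨E', hE1', hE'⟩ := hν.exists_scale (5 / σ)
  refine ⟨2 * E * (C * 3) + E' * (C * 3), fun u g hu hP z hz t ht => ?_⟩
  have h0 := (hν.pos z hz t ht).ne'
  have h1 := hP.average_sub_average_le hu hz (r := 3 * t) (by positivity)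
    (ball_subset_ball (by linarith)) (hE z hz t ht _ Subset.rfl) h0
  have e3 : ENNReal.ofReal (3 * t) = 3 * ENNReal.ofReal t := by
    rw [ENNReal.ofReal_mul (by norm_num)]; simp
  rw [e3] at h1
  refine ⟨(laverage_sub_average_le h0 hu _).trans ((mul_le_mul_right h1.1 2).trans ?_),
    fun y hy hyz => ?_⟩
  · calc _ = (2 * E * (C * 3)) * ballEnergy ν θ lam g t z := by rw [ballEnergy]; ring
      _ ≤ _ := by push_cast; gcongr; exact le_self_add
  · have h2 := hP.average_sub_average_le hu hz (r := 3 * t) (A := ball y (σ * t)) (M := E')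
      (by positivity) (ball_subset_ball' (by nlinarith)) ?_ (hν.pos y hy _ (by positivity)).ne'
    · rw [e3] at h2
      refine (enorm_sub_le_add _ _ _).trans ((add_le_add h2.2 h1.2).trans ?_)
      calc _ = (E' * (C * 3) + E * (C * 3)) * ballEnergy ν θ lam g t z := by rw [ballEnergy]; ring
        _ ≤ _ := by
          push_cast
          gcongr ?_ * _
          rw [add_comm, mul_assoc 2]
          gcongr ?_ + _
          rw [two_mul]
          exact le_self_add
    · refine hE' y hy _ (by positivity) _ (ball_subset_ball' ?_)
      rw [dist_comm]
      have : 5 / σ * (σ * t) = 5 * t := by field_simp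
      linarith

/-- The density defining the non-tangential energy at height `t` above the boundary. -/
noncomputable def coneDensity (ν : Measure X) (G : Set X) (θ c t : ℝ) : X → ℝ≥0∞ :=
  {x | c / 2 * t ≤ infDist x G}.indicator fun x => ENNReal.ofReal (t ^ θ) / ν (ball x t)

/-- The non-tangential energy of `τ` at height `t` above `z`. -/
noncomputable def coneEnergy (ν τ : Measure X) (G : Set X) (θ c t : ℝ) (z : X) : ℝ≥0∞ :=
  ∫⁻ x in ball z (3 * t), coneDensity ν G θ c t x ∂τ

lemma measurable_coneDensity : Measurable (coneDensity ν G θ c R) := by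
  refine Measurable.indicator (measurable_const.div (measurable_measure_ball _ _)) ?_
  exact measurableSet_le measurable_const (continuous_infDist_pt G).measurable

lemma measurable_coneEnergy : Measurable (coneEnergy ν τ G θ c R) := by
  unfold coneEnergy
  simp_rw [← withDensity_apply (μ := τ) (coneDensity ν G θ c R) measurableSet_ball]
  exact measurable_measure_ball _ _

/-- By Tonelli, the density at x gets multiplied by H(B(x,3t)). Codimension regularity bounds this
by C t^(-θ) ν(B(x,t)), exactly cancelling the normalization in `coneDensity`. What remains is the
indicator of a layer at distance comparable to t from G, and the layers overlap boundedly. -/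
lemma exists_lintegral_coneEnergy_le [IsFiniteMeasure ν] [IsFiniteMeasure H]
    (hν : DoublingWith ν K D) (hK : IsCompact K) (hFK : F ⊆ K) (hFG : F ⊆ G)
    (hHF : ∀ᵐ z ∂H, z ∈ F) (hH : CodimWith ν H F θ Ch R₁) (hθ : 0 ≤ θ) (hc : 0 < c)
    (hR : 0 < R) (hRR₁ : 6 * R < R₁) {p : ℝ} (hp0 : 0 < p) (hp1 : p < 1) :
    ∃ C' : ℝ≥0, ∀ τ : Measure X, IsFiniteMeasure τ → (∀ᵐ x ∂τ, x ∈ K) →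
      ∫⁻ z, ∑' k : ℕ, coneEnergy ν τ G θ c (R * p ^ k) z ∂H ≤ C' * τ univ := by
  obtain ⟨E, hE1, hE⟩ := hν.exists_scale 9
  obtain ⟨N, hN⟩ := tsum_indicator_geometric_le hc hp0 hp1 hR
  refine ⟨Ch * E * N, fun τ hτ hτK => ?_⟩
  have hHK : ∀ᵐ z ∂H, z ∈ K := hHF.mono fun z hz => hFK hz
  rw [lintegral_tsum fun k => measurable_coneEnergy.aemeasurable]
  have hk : ∀ k : ℕ, ∫⁻ z, coneEnergy ν τ G θ c (R * p ^ k) z ∂H ≤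
      ∫⁻ x, Ch * E * (if c / 2 * (R * p ^ k) ≤ infDist x G ∧ infDist x G < 3 * (R * p ^ k)
        then (1 : ℝ≥0∞) else 0) ∂τ := by
    intro k
    have ht : 0 < R * p ^ k := by positivity
    have htR : R * p ^ k ≤ R := mul_le_of_le_one_right hR.le (pow_le_one₀ hp0.le hp1.le)
    generalize R * p ^ k = t at ht htR
    unfold coneEnergy
    rw [lintegral_lintegral_ball_swap hK H τ hHK hτK measurable_coneDensity]
    refine lintegral_mono_ae ?_
    filter_upwards [hτK] with x hxK
    rcases eq_or_ne (H (ball x (3 * t))) 0 with h0 | h0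
    · simp [h0]
    -- Regularity is only assumed at centers in F. If the ball has positive H-mass it contains such
    -- a z, and B(x,3t) ⊆ B(z,6t) ⊆ B(x,9t).
    obtain ⟨z, hzx, hzF⟩ : ∃ z ∈ ball x (3 * t), z ∈ F :=
      ((frequently_ae_mem_iff.2 h0).and_eventually hHF).exists
    have hzx' : dist x z < 3 * t := by rw [dist_comm]; exact hzx
    have hδ : infDist x G < 3 * t := (infDist_le_dist_of_mem (hFG hzF)).trans_lt hzx'
    by_cases hcx : c / 2 * t ≤ infDist x G
    swap
    · have hmem : x ∉ {x | c / 2 * t ≤ infDist x G} := hcx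
      rw [coneDensity, indicator_of_notMem hmem]
      simp
    rw [coneDensity, indicator_of_mem (by exact hcx), if_pos ⟨hcx, hδ⟩, mul_one]
    have ht0 : ENNReal.ofReal (t ^ θ) ≠ 0 := by
      rw [Ne, ENNReal.ofReal_eq_zero, not_le]; positivity
    have hx0 := (hν.pos x hxK t ht).ne'
    calc ENNReal.ofReal (t ^ θ) / ν (ball x t) * H (ball x (3 * t))
        ≤ ENNReal.ofReal (t ^ θ) / ν (ball x t) *
            (Ch * (E * ν (ball x t) / ENNReal.ofReal (t ^ θ))) := by
          gcongr
          calc H (ball x (3 * t)) ≤ H (ball z (6 * t)) :=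
                measure_mono (ball_subset_ball' (by linarith))
            _ ≤ Ch * (ν (ball z (6 * t)) / ENNReal.ofReal ((6 * t) ^ θ)) :=
                hH z hzF _ (by positivity) (by linarith)
            _ ≤ _ := by
                gcongr
                · refine hE x hxK t ht _ (ball_subset_ball' ?_)
                  rw [dist_comm]; linarith
                · linarith
      _ = Ch * E * (ENNReal.ofReal (t ^ θ) * (ENNReal.ofReal (t ^ θ))⁻¹) *
            ((ν (ball x t)) * (ν (ball x t))⁻¹) := by
          rw [div_eq_mul_inv, div_eq_mul_inv]; ring
      _ = Ch * E := by
          rw [ENNReal.mul_inv_cancel ht0 ENNReal.ofReal_ne_top,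
            ENNReal.mul_inv_cancel hx0 (measure_ne_top _ _), mul_one, mul_one]
  have hm : ∀ k : ℕ, Measurable fun x => (Ch * E * (if c / 2 * (R * p ^ k) ≤ infDist x G ∧
      infDist x G < 3 * (R * p ^ k) then (1 : ℝ≥0∞) else 0) : ℝ≥0∞) := by
    intro k
    refine Measurable.const_mul (Measurable.ite ?_ measurable_const measurable_const) _
    have hδm : Measurable fun x => infDist x G := (continuous_infDist_pt G).measurable
    exact (measurableSet_le measurable_const hδm).inter (measurableSet_lt hδm measurable_const)
  calc ∑' k : ℕ, ∫⁻ z, coneEnergy ν τ G θ c (R * p ^ k) z ∂H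
      ≤ ∑' k : ℕ, ∫⁻ x, Ch * E * (if c / 2 * (R * p ^ k) ≤ infDist x G ∧
          infDist x G < 3 * (R * p ^ k) then (1 : ℝ≥0∞) else 0) ∂τ := ENNReal.tsum_le_tsum hk
    _ = ∫⁻ x, ∑' k : ℕ, Ch * E * (if c / 2 * (R * p ^ k) ≤ infDist x G ∧
          infDist x G < 3 * (R * p ^ k) then (1 : ℝ≥0∞) else 0) ∂τ :=
        (lintegral_tsum fun k => (hm k).aemeasurable).symm
    _ ≤ ∫⁻ x, Ch * E * N ∂τ := by
        refine lintegral_mono fun x => ?_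
        rw [ENNReal.tsum_mul_left]
        gcongr
        exact hN _
    _ = _ := by rw [lintegral_const]; push_cast; ring

/-- Comparison of `τ` with the weighted energy of `g`: near the boundary set `F`, the weight is
at least `ω` of the distance. -/
def DominatesEnergy (ν τ : Measure X) (F : Set X) (θ : ℝ) (ω : ℝ → ℝ) (g : X → ℝ≥0∞) : Prop :=
  ∀ z ∈ F, ∀ t : ℝ, 0 < t → ∀ A : Set X, MeasurableSet A → A ⊆ ball z t →
    ENNReal.ofReal (ω t) * ∫⁻ x in A, g x ^ θ ∂ν ≤ τ A

/-- Both small balls lie in B(y, 2σt). The choice of σ makes its Poincaré dilation have radius ct/2,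
so that the dilated ball keeps distance at least ct/2 from G and its energy is counted in
`coneEnergy`. It also lies in B(z,3t), where the weight is at least ω(3t). -/
lemma exists_step_le [IsFiniteMeasure ν] (hν : DoublingWith ν K D) (C : ℝ≥0) (hc : 0 < c)
    (hc1 : c ≤ 1) (hlam : 1 ≤ lam) (hθ : 1 < θ) {ω : ℝ → ℝ} (hω1 : ∀ t, 0 < t → 1 ≤ ω t)
    {σ : ℝ} (hσ : 4 * lam * σ = c) :
    ∃ C' : ℝ≥0, ∀ (u : X → V) (g : X → ℝ≥0∞) (τ : Measure X), Integrable u ν →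
      PoincareOn ν K θ C lam u g → DominatesEnergy ν τ F θ ω g →
      ∀ z ∈ F, ∀ t : ℝ, 0 < t → ∀ y ∈ K, ∀ y' ∈ K, dist y z ≤ 2 * t → c * t ≤ infDist y G →
        dist y' y ≤ σ * t →
        ‖(⨍ x in ball y (σ * t), u x ∂ν) - ⨍ x in ball y' (σ * ((1 - σ) * t)), u x ∂ν‖ₑ ≤
          C' * (ENNReal.ofReal (ω (3 * t)) ^ (-1 / θ) * coneEnergy ν τ G θ c t z ^ (1 / θ)) := by
  have hσ0 : 0 < σ := by
    by_contra h
    have : 4 * lam * σ ≤ 0 := mul_nonpos_of_nonneg_of_nonpos (by linarith) (not_lt.1 h)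
    linarith
  have hσ4 : σ ≤ 1 / 4 := by nlinarith
  have hθ0 : 0 < θ := by linarith
  obtain ⟨E, hE1, hE⟩ := hν.exists_scale 4
  obtain ⟨E', hE1', hE'⟩ := hν.exists_scale (4 / c)
  obtain ⟨P, hP'⟩ : ∃ P : ℝ≥0, (P : ℝ≥0∞) = (E' : ℝ≥0∞) ^ (1 / θ) :=
    ⟨E' ^ (1 / θ), ENNReal.coe_rpow_of_nonneg _ (by positivity)⟩
  refine ⟨2 * E * C * P, fun u g τ hu hP hdom z hz t ht y hy y' hy' hyz hyG hyy' => ?_⟩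
  have hσt : 0 < σ * t := by positivity
  have hσt' : 0 < σ * ((1 - σ) * t) := mul_pos hσ0 (mul_pos (by linarith) ht)
  -- The next radius loses at most a quarter, so B(y, 2σt), contained in B(y', 3σt), is at most 4
  -- times the next ball.
  have h34 : 3 / 4 * (σ * t) ≤ σ * ((1 - σ) * t) := by nlinarith
  have hr : 0 < 2 * (σ * t) := by positivity
  have h1 := hP.average_sub_average_le hu hy hr (A := ball y (σ * t)) (M := E)
    (ball_subset_ball (by linarith)) (hE y hy _ hσt _ (ball_subset_ball (by linarith)))
    (hν.pos y hy _ hσt).ne'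
  have h2 := hP.average_sub_average_le hu hy hr (A := ball y' (σ * ((1 - σ) * t))) (M := E)
    (ball_subset_ball' (by nlinarith)) (hE y' hy' _ hσt' _ (ball_subset_ball' (by
      rw [dist_comm]; linarith))) (hν.pos y' hy' _ hσt').ne'
  have hrad : lam * (2 * (σ * t)) = c / 2 * t := by rw [← hσ]; ring
  rw [hrad] at h1 h2
  set B := ball y (c / 2 * t) with hB
  have hBz : B ⊆ ball z (3 * t) := ball_subset_ball' (by nlinarith)
  have hct : 0 < c / 2 * t := by positivity
  have hB0 : ν B ≠ 0 := (hν.pos y hy _ hct).ne'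
  set W : ℝ≥0∞ := ENNReal.ofReal (ω (3 * t)) with hW
  have hW0 : W ≠ 0 := by
    have := hω1 (3 * t) (by positivity)
    rw [hW, Ne, ENNReal.ofReal_eq_zero]; linarith
  have hWt : W ≠ ∞ := ENNReal.ofReal_ne_top
  have henergy : ENNReal.ofReal (t ^ θ) * ⨍⁻ x in B, g x ^ θ ∂ν ≤
      E' * (W⁻¹ * coneEnergy ν τ G θ c t z) := by
    have ha : ∫⁻ x in B, g x ^ θ ∂ν ≤ W⁻¹ * τ B := by
      rw [← ENNReal.mul_le_iff_le_inv hW0 hWt]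
      exact hdom z hz _ (by positivity) B measurableSet_ball hBz
    have hb : ENNReal.ofReal (t ^ θ) / ν B * τ B ≤ E' * coneEnergy ν τ G θ c t z := by
      rw [← setLIntegral_const, coneEnergy, ← lintegral_const_mul _ measurable_coneDensity]
      refine (setLIntegral_mono' measurableSet_ball fun x hx => ?_).trans (lintegral_mono_set hBz)
      have hx' : dist y x < c / 2 * t := by rw [dist_comm]; exact hx
      have hxG : c / 2 * t ≤ infDist x G := by
        have := infDist_le_infDist_add_dist (s := G) (x := y) (y := x)
        linarith
      rw [coneDensity, indicator_of_mem (by exact hxG)]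
      have hsub : ball x t ⊆ ball y (4 / c * (c / 2 * t)) := by
        refine ball_subset_ball' ?_
        have : 4 / c * (c / 2 * t) = 2 * t := by field_simp; norm_num
        rw [dist_comm, this]
        nlinarith
      have hle := hE' y hy _ hct _ hsub
      have hx0 : ν (ball x t) ≠ 0 := by
        refine fun h => hB0 (measure_mono_null (ball_subset_ball' ?_) h)
        nlinarith
      exact div_le_mul_div_of_le_mul hB0 (measure_ne_top _ _) hx0 (measure_ne_top _ _) hle
    calc ENNReal.ofReal (t ^ θ) * ⨍⁻ x in B, g x ^ θ ∂ν
        ≤ ENNReal.ofReal (t ^ θ) * ((W⁻¹ * τ B) / ν B) := by rw [setLAverage_eq]; gcongr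
      _ = W⁻¹ * (ENNReal.ofReal (t ^ θ) / ν B * τ B) := by
          rw [div_eq_mul_inv, div_eq_mul_inv]; ring
      _ ≤ W⁻¹ * (E' * coneEnergy ν τ G θ c t z) := by gcongr
      _ = _ := by ring
  have hroot : ENNReal.ofReal t * (⨍⁻ x in B, g x ^ θ ∂ν) ^ (1 / θ) ≤
      P * (W ^ (-1 / θ) * coneEnergy ν τ G θ c t z ^ (1 / θ)) := by
    have h := ENNReal.rpow_le_rpow henergy (z := 1 / θ) (by positivity)
    rw [ENNReal.mul_rpow_of_nonneg _ _ (by positivity),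
      ENNReal.mul_rpow_of_nonneg _ _ (by positivity),
      ENNReal.mul_rpow_of_nonneg _ _ (by positivity), ← hP', ENNReal.inv_rpow, ← ENNReal.rpow_neg,
      ENNReal.ofReal_rpow_of_nonneg (by positivity) (by positivity), ← Real.rpow_mul ht.le,
      mul_one_div_cancel hθ0.ne', Real.rpow_one] at h
    rwa [neg_div]
  have hσ2 : ENNReal.ofReal (2 * (σ * t)) ≤ ENNReal.ofReal t :=
    ENNReal.ofReal_le_ofReal (by nlinarith)
  refine (enorm_sub_le_add _ _ _).trans ((add_le_add h1.2 h2.2).trans ?_)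
  calc _ ≤ E * (C * ENNReal.ofReal t * (⨍⁻ x in B, g x ^ θ ∂ν) ^ (1 / θ)) +
        E * (C * ENNReal.ofReal t * (⨍⁻ x in B, g x ^ θ ∂ν) ^ (1 / θ)) := by gcongr
    _ = 2 * E * C * (ENNReal.ofReal t * (⨍⁻ x in B, g x ^ θ ∂ν) ^ (1 / θ)) := by ring
    _ ≤ 2 * E * C * (P * (W ^ (-1 / θ) * coneEnergy ν τ G θ c t z ^ (1 / θ))) := by gcongr
    _ = _ := by push_cast; ring

end Chains

/-! ### Existence of traces at good boundary points. -/

section Trace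

variable {X : Type*} [MetricSpace X] [MeasurableSpace X] [BorelSpace X] {ν H τ : Measure X}
  {K F G : Set X} {D Ch C : ℝ≥0} {θ R₁ R c lam : ℝ}
  {V : Type*} [NormedAddCommGroup V] [NormedSpace ℝ V] [CompleteSpace V]

/-- Every `z ∈ F` can be approached, at all heights between `s` and `R`, along a curve in `K` whose
distance to `G` is comparable to the height. -/
def HasChains (K F G : Set X) (c R : ℝ) : Prop :=
  ∀ z ∈ F, ∀ s : ℝ, 0 < s → s ≤ R → ∃ y : ℝ → X,
    (∀ t ∈ Icc s R, y t ∈ K ∧ dist (y t) z ≤ 2 * t ∧ c * t ≤ infDist (y t) G) ∧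
    ∀ t ∈ Icc s R, ∀ t' ∈ Icc s R, dist (y t) (y t') ≤ |t - t'|

/-- The tails of the weight series along the radii `R * p ^ k`. -/
noncomputable def weightTail (ω : ℝ → ℝ) (θ R p : ℝ) (i : ℕ) : ℝ≥0∞ :=
  ∑' k : ℕ, ENNReal.ofReal (ω (3 * (R * p ^ (k + i))) ^ (-1 / (θ - 1)))

/-- Hölder's inequality, where the critical exponent appears: ω^(-1/θ) raised to the conjugate power
θ/(θ-1) is ω^(-1/(θ-1)). -/
lemma sum_mul_coneEnergy_le {ω : ℝ → ℝ} (hω1 : ∀ t, 0 < t → 1 ≤ ω t) (hθ : 1 < θ) {p : ℝ}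
    (hp0 : 0 < p) (hR : 0 < R) (z : X) (i n : ℕ) :
    ∑ k ∈ Finset.Ico i n, ENNReal.ofReal (ω (3 * (R * p ^ k))) ^ (-1 / θ) *
        coneEnergy ν τ G θ c (R * p ^ k) z ^ (1 / θ) ≤
      weightTail ω θ R p i ^ ((θ - 1) / θ) *
        (∑' k : ℕ, coneEnergy ν τ G θ c (R * p ^ k) z) ^ (1 / θ) := by
  have hθ0 : 0 < θ := by linarith
  have hθ1 : 0 < θ - 1 := by linarith
  have hconj : (θ / (θ - 1)).HolderConjugate θ := by
    rw [Real.holderConjugate_iff]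
    refine ⟨by rw [lt_div_iff₀ hθ1]; linarith, ?_⟩
    field_simp
    ring
  refine (ENNReal.inner_le_Lp_mul_Lq _ _ _ hconj).trans ?_
  rw [one_div_div]
  refine mul_le_mul' (ENNReal.rpow_le_rpow ?_ (by positivity))
    (ENNReal.rpow_le_rpow ?_ (by positivity))
  · have e : ∀ k : ℕ, (ENNReal.ofReal (ω (3 * (R * p ^ k))) ^ (-1 / θ)) ^ (θ / (θ - 1)) =
        ENNReal.ofReal (ω (3 * (R * p ^ k)) ^ (-1 / (θ - 1))) := by
      intro k
      have := hω1 (3 * (R * p ^ k)) (by positivity)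
      rw [← ENNReal.rpow_mul, ENNReal.ofReal_rpow_of_pos (by linarith)]
      congr 2
      field_simp
    simp_rw [e]
    rw [Finset.sum_Ico_eq_sum_range, weightTail]
    simp_rw [add_comm i]
    exact ENNReal.sum_le_tsum _
  · have e : ∀ k : ℕ, (coneEnergy ν τ G θ c (R * p ^ k) z ^ (1 / θ)) ^ θ =
        coneEnergy ν τ G θ c (R * p ^ k) z := by
      intro k
      rw [← ENNReal.rpow_mul, one_div_mul_cancel hθ0.ne', ENNReal.rpow_one]
    simp_rw [e]
    exact ENNReal.sum_le_tsum _

/-- Go from B(z, r_n) to the chain, along the chain up to height r_i, and back to B(z, r_i). The end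
jumps cost `ballEnergy`; the path along the chain is summed by Hölder. -/
lemma exists_enorm_average_sub_le [IsFiniteMeasure ν] (hν : DoublingWith ν K D) (hFK : F ⊆ K)
    (hch : HasChains K F G c R) (hR : 0 < R) (C : ℝ≥0) (hc : 0 < c) (hc1 : c ≤ 1)
    (hlam : 1 ≤ lam) (hθ : 1 < θ) {ω : ℝ → ℝ} (hω1 : ∀ t, 0 < t → 1 ≤ ω t)
    {σ : ℝ} (hσ0 : 0 < σ) (hσ1 : σ < 1) (hσ : 4 * lam * σ = c) :
    ∃ C' : ℝ≥0, ∀ (u : X → V) (g : X → ℝ≥0∞) (τ : Measure X), Integrable u ν →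
      PoincareOn ν K θ C lam u g → DominatesEnergy ν τ F θ ω g → ∀ z ∈ F,
      (∀ t : ℝ, 0 < t → ⨍⁻ y in ball z t, ‖u y - ⨍ x in ball z t, u x ∂ν‖ₑ ∂ν ≤
        C' * ballEnergy ν θ lam g t z) ∧
      ∀ i n : ℕ, i ≤ n →
      ‖(⨍ x in ball z (R * (1 - σ) ^ n), u x ∂ν) - ⨍ x in ball z (R * (1 - σ) ^ i), u x ∂ν‖ₑ ≤
        C' * (ballEnergy ν θ lam g (R * (1 - σ) ^ n) z +
          (ballEnergy ν θ lam g (R * (1 - σ) ^ i) z + weightTail ω θ R (1 - σ) i ^ ((θ - 1) / θ) *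
            (∑' k : ℕ, coneEnergy ν τ G θ c (R * (1 - σ) ^ k) z) ^ (1 / θ))) := by
  obtain ⟨C₁, hC₁⟩ := exists_average_comparison (V := V) (θ := θ) hν C hσ0 hσ1.le lam
  obtain ⟨C₂, hC₂⟩ := exists_step_le (F := F) (G := G) (V := V) hν C hc hc1 hlam hθ hω1 hσ
  refine ⟨C₁ + C₂, fun u g τ hu hP hdom z hz => ⟨fun t ht =>
    ((hC₁ u g hu hP z (hFK hz) t ht).1).trans ?_, fun i n hin => ?_⟩⟩
  · push_cast
    gcongr
    exact le_self_add
  have hp0 : 0 < 1 - σ := by linarith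
  have hp1 : 1 - σ ≤ 1 := by linarith
  have hr : ∀ k : ℕ, 0 < R * (1 - σ) ^ k := fun k => by positivity
  have hanti : Antitone fun k : ℕ => R * (1 - σ) ^ k := by
    intro k l hkl
    exact mul_le_mul_of_nonneg_left (pow_le_pow_of_le_one hp0.le hp1 hkl) hR.le
  have hR0 : ∀ k : ℕ, R * (1 - σ) ^ k ≤ R := fun k => by simpa using hanti (Nat.zero_le k)
  -- The chain depends on n, but the final bound does not mention it, so no limiting curve reaching
  -- z is needed.
  obtain ⟨y, hy, hyd⟩ := hch z hz (R * (1 - σ) ^ n) (hr n) (hR0 n)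
  have hmem : ∀ k ≤ n, R * (1 - σ) ^ k ∈ Icc (R * (1 - σ) ^ n) R :=
    fun k hk => ⟨hanti hk, hR0 k⟩
  set b : ℕ → V := fun k => ⨍ x in ball (y (R * (1 - σ) ^ k)) (σ * (R * (1 - σ) ^ k)), u x ∂ν
    with hb
  have hbi : ∀ k ≤ n, ‖b k - ⨍ x in ball z (R * (1 - σ) ^ k), u x ∂ν‖ₑ ≤
      C₁ * ballEnergy ν θ lam g (R * (1 - σ) ^ k) z := by
    intro k hk
    obtain ⟨h1, h2, h3⟩ := hy _ (hmem k hk)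
    exact (hC₁ u g hu hP z (hFK hz) _ (hr k)).2 _ h1 h2
  have hstep : ∀ k ∈ Finset.Ico i n, edist (b k) (b (k + 1)) ≤
      C₂ * (ENNReal.ofReal (ω (3 * (R * (1 - σ) ^ k))) ^ (-1 / θ) *
        coneEnergy ν τ G θ c (R * (1 - σ) ^ k) z ^ (1 / θ)) := by
    intro k hk
    have hkn := (Finset.mem_Ico.1 hk).2
    obtain ⟨h1, h2, h3⟩ := hy _ (hmem k hkn.le)
    obtain ⟨h1', -, -⟩ := hy _ (hmem (k + 1) hkn)
    have e : R * (1 - σ) ^ (k + 1) = (1 - σ) * (R * (1 - σ) ^ k) := by rw [pow_succ]; ring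
    -- Consecutive heights differ by exactly σ r_k, and the curve is 1-Lipschitz in the height.
    have hd : dist (y (R * (1 - σ) ^ (k + 1))) (y (R * (1 - σ) ^ k)) ≤
        σ * (R * (1 - σ) ^ k) := by
      refine (hyd _ (hmem (k + 1) hkn) _ (hmem k hkn.le)).trans (le_of_eq ?_)
      rw [e, abs_sub_comm, abs_of_nonneg]
      · ring
      · have := hr k
        nlinarith
    have h := hC₂ u g τ hu hP hdom z hz _ (hr k) _ h1 _ h1' h2 h3 hd
    rw [edist_eq_enorm_sub]
    rwa [← e] at h
  have hsum : ‖b n - b i‖ₑ ≤ C₂ * (weightTail ω θ R (1 - σ) i ^ ((θ - 1) / θ) *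
      (∑' k : ℕ, coneEnergy ν τ G θ c (R * (1 - σ) ^ k) z) ^ (1 / θ)) := by
    rw [← edist_eq_enorm_sub, edist_comm]
    refine (edist_le_Ico_sum_edist b hin).trans ((Finset.sum_le_sum hstep).trans ?_)
    rw [← Finset.mul_sum]
    gcongr
    exact sum_mul_coneEnergy_le hω1 hθ hp0 hR z i n
  set an : V := ⨍ x in ball z (R * (1 - σ) ^ n), u x ∂ν
  set ai : V := ⨍ x in ball z (R * (1 - σ) ^ i), u x ∂ν
  have e : an - ai = -(b n - an) + ((b i - ai) + (b n - b i)) := by abel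
  rw [e]
  refine (enorm_add_le _ _).trans ((add_le_add (le_of_eq (enorm_neg _)) (enorm_add_le _ _)).trans ?_)
  refine (add_le_add (hbi n le_rfl) (add_le_add (hbi i hin) hsum)).trans ?_
  rw [mul_add, mul_add]
  push_cast
  gcongr
  · exact le_self_add
  · exact le_self_add
  · exact le_add_self

/-- `v` is the trace of `u` at `z`, with respect to `ν`. -/
def TraceAt (ν : Measure X) (u : X → V) (z : X) (v : V) : Prop :=
  Tendsto (fun r : ℝ => ⨍⁻ x in ball z r, ‖u x - v‖ₑ ∂ν) (𝓝[>] 0) (𝓝 0)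

lemma TraceAt.unique [IsFiniteMeasure ν] (hν : DoublingWith ν K D) {u : X → V}
    (hu : AEStronglyMeasurable u ν) {z : X} (hz : z ∈ K) {v w : V} (hv : TraceAt ν u z v)
    (hw : TraceAt ν u z w) : v = w := by
  have h := hv.add hw
  rw [add_zero] at h
  have h0 : ‖v - w‖ₑ ≤ 0 := by
    refine ge_of_tendsto h ?_
    filter_upwards [self_mem_nhdsWithin] with r hr
    have hpos := (hν.pos z hz r hr).ne'
    rw [← setLAverage_add (f := fun x => ‖u x - v‖ₑ) (hu.sub aestronglyMeasurable_const).enorm,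
      ← setLAverage_const hpos (measure_ne_top _ _) ‖v - w‖ₑ]
    refine laverage_mono_ae (Eventually.of_forall fun x => ?_)
    have := enorm_sub_le_add v w (u x)
    rwa [← edist_eq_enorm_sub v (u x), edist_comm, edist_eq_enorm_sub, ← edist_eq_enorm_sub w,
      edist_comm w, edist_eq_enorm_sub] at this
  have h1 : ‖v - w‖ₑ = 0 := le_antisymm h0 bot_le
  exact sub_eq_zero.1 (by simpa using h1)

/-- Any small r lies between two consecutive radii, whose ball masses are comparable by doubling. -/
lemma traceAt_of_tendsto_geometric [IsFiniteMeasure ν] (hν : DoublingWith ν K D) {u : X → V}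
    {z : X} (hz : z ∈ K) {v : V} (hR : 0 < R) {p : ℝ} (hp0 : 0 < p) (hp1 : p < 1)
    (h : Tendsto (fun n : ℕ => ⨍⁻ x in ball z (R * p ^ n), ‖u x - v‖ₑ ∂ν) atTop (𝓝 0)) :
    TraceAt ν u z v := by
  obtain ⟨E, hE1, hE⟩ := hν.exists_scale (1 / p)
  have h' := ENNReal.Tendsto.const_mul h (Or.inr (ENNReal.coe_ne_top (r := E)))
  rw [mul_zero, ENNReal.tendsto_nhds_zero] at h'
  rw [TraceAt, ENNReal.tendsto_nhds_zero]
  intro ε hε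
  obtain ⟨N, hN⟩ := eventually_atTop.1 (h' ε hε)
  have hRN : 0 < R * p ^ N := by positivity
  filter_upwards [Ioo_mem_nhdsGT hRN] with r hr
  have hr0 : 0 < r := hr.1
  have hrR : r / R ≤ 1 := by
    rw [div_le_one hR]
    exact hr.2.le.trans (mul_le_of_le_one_right hR.le (pow_le_one₀ hp0.le hp1.le))
  obtain ⟨n, hn1, hn2⟩ := exists_nat_pow_near_of_lt_one (div_pos hr0 hR) hrR hp0 hp1
  rw [lt_div_iff₀ hR] at hn1
  rw [div_le_iff₀ hR] at hn2
  have hNn : N ≤ n := by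
    by_contra hlt
    have h1 : p ^ N ≤ p ^ (n + 1) := pow_le_pow_of_le_one hp0.le hp1.le (by omega)
    have := mul_le_mul_of_nonneg_left h1 hR.le
    linarith [hr.2]
  refine le_trans ?_ (hN n hNn)
  refine laverage_le_mul_laverage (ball_subset_ball (by linarith)) ?_ (hν.pos z hz r hr0).ne' _
  refine hE z hz r hr0 _ (ball_subset_ball ?_)
  rw [one_div_mul_eq_div, le_div_iff₀ hp0]
  rw [pow_succ] at hn1
  linarith

lemma tendsto_geometric_nhdsGT {p : ℝ} (hR : 0 < R) (hp0 : 0 < p) (hp1 : p < 1) :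
    Tendsto (fun k : ℕ => R * p ^ k) atTop (𝓝[>] 0) := by
  refine tendsto_nhdsWithin_iff.2 ⟨?_, Eventually.of_forall fun k => mem_Ioi.2 (by positivity)⟩
  simpa using (tendsto_pow_atTop_nhds_zero_of_lt_one hp0.le hp1).const_mul R

/-- The averages are Cauchy because the tails of the weight series and the ball energies vanish. The
oscillation bound upgrades convergence of averages to convergence in mean, and comparison with scale
0 gives the norm estimate. -/
lemma exists_traceAt [IsFiniteMeasure ν] (hν : DoublingWith ν K D) (hFK : F ⊆ K)
    (hch : HasChains K F G c R) (hR : 0 < R) (C : ℝ≥0) (hc : 0 < c) (hc1 : c ≤ 1)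
    (hlam : 1 ≤ lam) (hθ : 1 < θ) {ω : ℝ → ℝ} (hω1 : ∀ t, 0 < t → 1 ≤ ω t)
    {σ : ℝ} (hσ0 : 0 < σ) (hσ1 : σ < 1) (hσ : 4 * lam * σ = c)
    (hω : weightTail ω θ R (1 - σ) 0 ≠ ∞) :
    ∃ C' : ℝ≥0, ∀ (u : X → V) (g : X → ℝ≥0∞) (τ : Measure X), Integrable u ν →
      PoincareOn ν K θ C lam u g → DominatesEnergy ν τ F θ ω g → ∀ z ∈ F,
      Tendsto (fun t => ballEnergy ν θ lam g t z) (𝓝[>] 0) (𝓝 0) →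
      ∑' k : ℕ, coneEnergy ν τ G θ c (R * (1 - σ) ^ k) z ≠ ∞ →
      ∃ v, TraceAt ν u z v ∧ ‖v‖ₑ ≤ ‖⨍ x in ball z R, u x ∂ν‖ₑ +
        C' * (ballEnergy ν θ lam g R z + weightTail ω θ R (1 - σ) 0 ^ ((θ - 1) / θ) *
            (∑' k : ℕ, coneEnergy ν τ G θ c (R * (1 - σ) ^ k) z) ^ (1 / θ)) := by
  obtain ⟨C', hC'⟩ := exists_enorm_average_sub_le (V := V) hν hFK hch hR C hc hc1 hlam hθ hω1
    hσ0 hσ1 hσ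
  refine ⟨C', fun u g τ hu hP hdom z hz hball hcone => ?_⟩
  obtain ⟨hosc, hdiff⟩ := hC' u g τ hu hP hdom z hz
  have hp0 : 0 < 1 - σ := by linarith
  have hp1 : 1 - σ < 1 := by linarith
  have hθ0 : 0 < θ := by linarith
  have hr : ∀ k : ℕ, 0 < R * (1 - σ) ^ k := fun k => by positivity
  set S := ∑' k : ℕ, coneEnergy ν τ G θ c (R * (1 - σ) ^ k) z
  set a : ℕ → V := fun n => ⨍ x in ball z (R * (1 - σ) ^ n), u x ∂ν with ha
  set e : ℕ → ℝ≥0∞ := fun n => ballEnergy ν θ lam g (R * (1 - σ) ^ n) z with he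
  have he0 : Tendsto e atTop (𝓝 0) := hball.comp (tendsto_geometric_nhdsGT hR hp0 hp1)
  have hCe0 : Tendsto (fun n => C' * e n) atTop (𝓝 0) := by
    simpa using ENNReal.Tendsto.const_mul he0 (Or.inr (ENNReal.coe_ne_top (r := C')))
  have htail : Tendsto (fun i => weightTail ω θ R (1 - σ) i ^ ((θ - 1) / θ) * S ^ (1 / θ))
      atTop (𝓝 0) := by
    have h1 : Tendsto (fun i => weightTail ω θ R (1 - σ) i) atTop (𝓝 0) :=
      ENNReal.tendsto_sum_nat_add
        (fun k => ENNReal.ofReal (ω (3 * (R * (1 - σ) ^ k)) ^ (-1 / (θ - 1)))) hω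
    have h2 := h1.ennrpow_const ((θ - 1) / θ)
    rw [ENNReal.zero_rpow_of_pos (div_pos (by linarith) hθ0)] at h2
    have h3 := ENNReal.Tendsto.mul_const h2
      (Or.inr (ENNReal.rpow_ne_top_of_nonneg (by positivity : 0 ≤ 1 / θ) hcone))
    rwa [zero_mul] at h3
  set b : ℕ → ℝ≥0∞ := fun i => C' * (e i + weightTail ω θ R (1 - σ) i ^ ((θ - 1) / θ) *
    S ^ (1 / θ)) with hb
  have hb0 : Tendsto b atTop (𝓝 0) := by
    have h1 := he0.add htail
    rw [add_zero] at h1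
    have h2 := ENNReal.Tendsto.const_mul h1 (Or.inr (ENNReal.coe_ne_top (r := C')))
    rwa [mul_zero] at h2
  have hab : ∀ i n, i ≤ n → ‖a n - a i‖ₑ ≤ C' * e n + b i := by
    intro i n hin
    rw [hb, ← mul_add]
    exact hdiff i n hin
  have hCauchy : CauchySeq a := by
    rw [EMetric.cauchySeq_iff]
    intro ε hε
    have hε2 : 0 < ε / 2 := ENNReal.half_pos hε.ne'
    obtain ⟨N, hN⟩ := eventually_atTop.1
      ((hCe0.eventually_lt_const hε2).and (hb0.eventually_lt_const hε2))
    have hlt : ∀ i ≥ N, ∀ n, i ≤ n → edist (a n) (a i) < ε := by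
      intro i hi n hin
      rw [edist_eq_enorm_sub]
      refine (hab i n hin).trans_lt ?_
      rw [← ENNReal.add_halves ε]
      exact ENNReal.add_lt_add (hN n (hi.trans hin)).1 (hN i hi).2
    refine ⟨N, fun m hm n hn => ?_⟩
    rcases le_total m n with h | h
    · rw [edist_comm]; exact hlt m hm n h
    · exact hlt n hn m h
  obtain ⟨v, hv⟩ := cauchySeq_tendsto_of_complete hCauchy
  refine ⟨v, traceAt_of_tendsto_geometric hν (hFK hz) hR hp0 hp1 ?_, ?_⟩
  · have hdist : Tendsto (fun n => ‖a n - v‖ₑ) atTop (𝓝 0) := by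
      simpa only [edist_eq_enorm_sub] using tendsto_iff_edist_tendsto_0.1 hv
    have hsum := hCe0.add hdist
    rw [add_zero] at hsum
    refine tendsto_of_tendsto_of_tendsto_of_le_of_le tendsto_const_nhds hsum (fun _ => bot_le)
      fun n => ?_
    refine (laverage_enorm_sub_le (hν.pos z (hFK hz) _ (hr n)).ne' hu.1 v (a n)).trans ?_
    exact add_le_add (hosc _ (hr n)) le_rfl
  · have h1 : ∀ n, ‖a n‖ₑ ≤ ‖a 0‖ₑ + (C' * e n + b 0) := by
      intro n
      calc ‖a n‖ₑ = ‖a 0 + (a n - a 0)‖ₑ := by rw [add_sub_cancel]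
        _ ≤ ‖a 0‖ₑ + ‖a n - a 0‖ₑ := enorm_add_le _ _
        _ ≤ _ := by gcongr; exact hab 0 n (Nat.zero_le n)
    have h2 : Tendsto (fun n => ‖a n‖ₑ) atTop (𝓝 ‖v‖ₑ) := (continuous_enorm.tendsto v).comp hv
    have h3 : Tendsto (fun n => ‖a 0‖ₑ + (C' * e n + b 0)) atTop (𝓝 (‖a 0‖ₑ + (0 + b 0))) :=
      tendsto_const_nhds.add (hCe0.add tendsto_const_nhds)
    have h4 := le_of_tendsto_of_tendsto' h2 h3 h1
    simpa [ha, hb, he] using h4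

end Trace

/-! ### Traces almost everywhere, their L^θ bound and measurability. -/

section TraceBound

variable {X : Type*} [MetricSpace X] [MeasurableSpace X] [BorelSpace X] {ν H τ : Measure X}
  {K F G : Set X} {D Ch C : ℝ≥0} {θ R₁ R c lam : ℝ}
  {V : Type*} [NormedAddCommGroup V] [NormedSpace ℝ V]

lemma ballEnergy_rpow (hθ : 0 < θ) {g : X → ℝ≥0∞} {t : ℝ} (ht : 0 < t) (z : X) :
    ballEnergy ν θ lam g t z ^ θ =
      ENNReal.ofReal (t ^ θ) * ⨍⁻ y in ball z (lam * (3 * t)), g y ^ θ ∂ν := by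
  rw [ballEnergy, ENNReal.mul_rpow_of_nonneg _ _ hθ.le, ← ENNReal.rpow_mul,
    one_div_mul_cancel hθ.ne', ENNReal.rpow_one, ENNReal.ofReal_rpow_of_pos ht]

/-- The θ-th power of `ballEnergy` is at most the density quotient of the measure g^θ ν with M = 3λ,
since ν(B(z,t)) ≤ ν(B(z,3λt)). -/
lemma ae_tendsto_ballEnergy [IsFiniteMeasure ν] (hν : DoublingWith ν K D) (hF : IsClosed F)
    (hFK : F ⊆ K) (hH : CodimWith ν H F θ Ch R₁) (hHF : ∀ᵐ z ∂H, z ∈ F) (hR₁ : 0 < R₁)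
    (hθ : 0 < θ) (hνF : ν F = 0) (hlam : 1 ≤ lam) {g : X → ℝ≥0∞}
    (hg : ∫⁻ x, g x ^ θ ∂ν ≠ ∞) :
    ∀ᵐ z ∂H, Tendsto (fun t => ballEnergy ν θ lam g t z) (𝓝[>] 0) (𝓝 0) := by
  have hfin : IsFiniteMeasure (ν.withDensity fun x => g x ^ θ) := isFiniteMeasure_withDensity hg
  have h := ae_tendsto_density_zero (τ := ν.withDensity fun x => g x ^ θ) (M := lam * 3) hν hF hFK
    hH hHF hR₁ hθ.le (withDensity_absolutelyContinuous _ _ hνF) (by linarith)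
  filter_upwards [h, hHF] with z hz hzF
  have h1 := hz.ennrpow_const (1 / θ)
  rw [ENNReal.zero_rpow_of_pos (by positivity)] at h1
  refine tendsto_of_tendsto_of_tendsto_of_le_of_le' tendsto_const_nhds h1
    (Eventually.of_forall fun _ => bot_le) ?_
  filter_upwards [self_mem_nhdsWithin] with t ht
  have ht : 0 < t := ht
  rw [one_div, ENNReal.le_rpow_inv_iff hθ, ballEnergy_rpow hθ ht, setLAverage_eq,
    withDensity_apply _ measurableSet_ball, mul_assoc lam, mul_div_assoc]
  gcongr
  nlinarith

variable [CompleteSpace V]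

/-- Existence of traces almost everywhere and the `L^θ`-bound for the trace. -/
lemma exists_trace_bound [IsFiniteMeasure ν] [IsFiniteMeasure H]
    (hν : DoublingWith ν K D) (hK : IsCompact K) (hF : IsClosed F) (hFne : F.Nonempty)
    (hFK : F ⊆ K) (hFG : F ⊆ G) (hHF : ∀ᵐ z ∂H, z ∈ F) (hνF : ν F = 0)
    (hH : CodimWith ν H F θ Ch R₁) (hch : HasChains K F G c R) (hR : 0 < R) (hRR₁ : 6 * R < R₁)
    (C : ℝ≥0) (hc : 0 < c) (hc1 : c ≤ 1) (hlam : 1 ≤ lam) (hθ : 1 < θ) {ω : ℝ → ℝ}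
    (hω1 : ∀ t, 0 < t → 1 ≤ ω t) {σ : ℝ} (hσ0 : 0 < σ) (hσ1 : σ < 1) (hσ : 4 * lam * σ = c)
    (hω : weightTail ω θ R (1 - σ) 0 ≠ ∞) :
    ∃ C' : ℝ≥0∞, C' ≠ ∞ ∧ ∀ (u : X → V) (g : X → ℝ≥0∞) (τ : Measure X), IsFiniteMeasure τ →
      (∀ᵐ x ∂τ, x ∈ K) → Integrable u ν → PoincareOn ν K θ C lam u g →
      DominatesEnergy ν τ F θ ω g → ∫⁻ x, g x ^ θ ∂ν ≤ τ univ →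
      (∀ᵐ z ∂H, ∃ v, TraceAt ν u z v) ∧ ∀ T : X → V, (∀ᵐ z ∂H, TraceAt ν u z (T z)) →
        ∫⁻ z, ‖T z‖ₑ ^ θ ∂H ≤ C' * ((∫⁻ x, ‖u x‖ₑ ^ θ ∂ν) + τ univ) := by
  have hθ0 : 0 < θ := by linarith
  have hp0 : 0 < 1 - σ := by linarith
  have hp1 : 1 - σ < 1 := by linarith
  obtain ⟨C₁, hC₁⟩ := exists_traceAt (V := V) hν hFK hch hR C hc hc1 hlam hθ hω1 hσ0 hσ1 hσ hω
  obtain ⟨C₂, hC₂⟩ := exists_lintegral_coneEnergy_le hν hK hFK hFG hHF hH hθ0.le hc hR hRR₁ hp0 hp1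
  obtain ⟨E, hE1, hE⟩ := hν.exists_scale ((diam K + 1) / R)
  obtain ⟨z₀, hz₀⟩ := hFne
  have hν0 : ν univ ≠ 0 := fun h =>
    (hν.pos z₀ (hFK hz₀) R hR).ne' (measure_mono_null (subset_univ _) h)
  -- As K is bounded, every ball of radius R carries a fixed proportion of the total mass; averages
  -- at scale R are then controlled by global integrals.
  have hE' : ∀ z ∈ K, ν univ ≤ E * ν (ball z R) := by
    intro z hz
    rw [measure_eq_measure_of_null_sdiff (subset_univ K)
      (by rw [← compl_eq_univ_sdiff]; exact hν.ae_mem) |>.symm]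
    refine hE z hz R hR _ fun x hx => ?_
    rw [div_mul_cancel₀ _ hR.ne', mem_ball]
    linarith [dist_le_diam_of_mem hK.isBounded hx hz]
  have hQ : ∀ z ∈ K, ∀ r, R ≤ r → ∀ f : X → ℝ≥0∞,
      ⨍⁻ x in ball z r, f x ∂ν ≤ E * (∫⁻ x, f x ∂ν) / ν univ := by
    intro z hz r hr f
    have h := laverage_le_mul_laverage (subset_univ (ball z r)) (M := E)
      ((hE' z hz).trans (by gcongr)) (hν.pos z hz r (hR.trans_le hr)).ne' f
    rwa [setLAverage_eq _ _ univ, Measure.restrict_univ, ← mul_div_assoc] at h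
  set S := weightTail ω θ R (1 - σ) 0 ^ ((θ - 1) / θ) with hS
  have hSt : S ≠ ∞ := ENNReal.rpow_ne_top_of_nonneg (div_nonneg (by linarith) hθ0.le) hω
  clear_value S
  -- The constant in (a+b)^θ ≤ 2^(θ-1)(a^θ + b^θ), used twice to separate the three terms of the
  -- pointwise bound.
  set A : ℝ≥0∞ := (2 : ℝ≥0∞) ^ (θ - 1) with hA
  have hAt : A ≠ ∞ := ENNReal.rpow_ne_top_of_nonneg (by linarith) (by simp)
  set Q : ℝ≥0∞ := E / ν univ with hQd
  have hQt : Q ≠ ∞ := ENNReal.div_ne_top ENNReal.coe_ne_top hν0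
  set P₁ : ℝ≥0∞ := A * (A * (Q + (C₁ : ℝ≥0∞) ^ θ * (ENNReal.ofReal (R ^ θ) * Q))) with hP₁
  set P₂ : ℝ≥0∞ := A * ((C₁ : ℝ≥0∞) ^ θ * S ^ θ) with hP₂
  have hC₁t : (C₁ : ℝ≥0∞) ^ θ ≠ ∞ := ENNReal.rpow_ne_top_of_nonneg hθ0.le ENNReal.coe_ne_top
  have hP₁t : P₁ ≠ ∞ := by
    refine ENNReal.mul_ne_top hAt (ENNReal.mul_ne_top hAt (ENNReal.add_ne_top.2 ⟨hQt, ?_⟩))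
    exact ENNReal.mul_ne_top hC₁t (ENNReal.mul_ne_top ENNReal.ofReal_ne_top hQt)
  have hP₂t : P₂ ≠ ∞ := ENNReal.mul_ne_top hAt (ENNReal.mul_ne_top hC₁t
    (ENNReal.rpow_ne_top_of_nonneg hθ0.le hSt))
  refine ⟨P₁ * H univ + P₂ * C₂, ENNReal.add_ne_top.2 ⟨ENNReal.mul_ne_top hP₁t
    (measure_ne_top _ _), ENNReal.mul_ne_top hP₂t ENNReal.coe_ne_top⟩, ?_⟩
  intro u g τ hτ hτK hu hP hdom hgτ
  set J : X → ℝ≥0∞ := fun z => ∑' k : ℕ, coneEnergy ν τ G θ c (R * (1 - σ) ^ k) z with hJ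
  have hJm : Measurable J := Measurable.tsum fun k => measurable_coneEnergy
  have hJint : ∫⁻ z, J z ∂H ≤ C₂ * τ univ := hC₂ τ hτ hτK
  have hJfin : ∀ᵐ z ∂H, J z < ∞ := ae_lt_top hJm
    (hJint.trans_lt (ENNReal.mul_lt_top ENNReal.coe_lt_top (measure_lt_top _ _))).ne
  have hball := ae_tendsto_ballEnergy hν hF hFK hH hHF (by linarith) hθ0 hνF hlam
    (hgτ.trans_lt (measure_lt_top _ _)).ne
  have hex : ∀ᵐ z ∂H, ∃ v, TraceAt ν u z v ∧ ‖v‖ₑ ≤ ‖⨍ x in ball z R, u x ∂ν‖ₑ +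
      C₁ * (ballEnergy ν θ lam g R z + S * J z ^ (1 / θ)) := by
    filter_upwards [hHF, hJfin, hball] with z hz h1 h2
    exact hC₁ u g τ hu hP hdom z hz h2 h1.ne
  refine ⟨hex.mono fun z ⟨v, hv, _⟩ => ⟨v, hv⟩, fun T hT => ?_⟩
  have hpt : ∀ᵐ z ∂H, ‖T z‖ₑ ^ θ ≤
      P₁ * ((∫⁻ x, ‖u x‖ₑ ^ θ ∂ν) + τ univ) + P₂ * J z := by
    filter_upwards [hex, hT, hHF] with z ⟨v, hv, hvb⟩ hTz hzF
    have hzK := hFK hzF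
    rw [TraceAt.unique hν hu.1 hzK hTz hv]
    have ha : ‖⨍ x in ball z R, u x ∂ν‖ₑ ^ θ ≤ Q * ∫⁻ x, ‖u x‖ₑ ^ θ ∂ν := by
      have h1 := laverage_rpow_le (ν := ν) (f := fun x => ‖u x‖ₑ ^ θ) (hu.1.enorm.pow_const θ)
        (hν.pos z hzK R hR).ne' hθ.le
      simp only [← ENNReal.rpow_mul, mul_one_div_cancel hθ0.ne', ENNReal.rpow_one] at h1
      have h2 := ((enorm_average_le _ u).trans h1)
      rw [one_div, ENNReal.le_rpow_inv_iff hθ0] at h2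
      refine (h2.trans (hQ z hzK R le_rfl _)).trans (le_of_eq ?_)
      rw [hQd, div_eq_mul_inv, div_eq_mul_inv]; ring
    have hb : ballEnergy ν θ lam g R z ^ θ ≤ ENNReal.ofReal (R ^ θ) * Q * τ univ := by
      rw [ballEnergy_rpow hθ0 hR, mul_assoc]
      gcongr
      refine (hQ z hzK _ (by nlinarith) _).trans ?_
      rw [hQd, div_eq_mul_inv, div_eq_mul_inv, mul_right_comm]
      gcongr
    calc ‖v‖ₑ ^ θ ≤ ((‖⨍ x in ball z R, u x ∂ν‖ₑ + C₁ * ballEnergy ν θ lam g R z) +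
          C₁ * (S * J z ^ (1 / θ))) ^ θ := by
          refine ENNReal.rpow_le_rpow (hvb.trans (le_of_eq ?_)) hθ0.le
          rw [mul_add, add_assoc]
      _ ≤ A * ((A * ((Q * ∫⁻ x, ‖u x‖ₑ ^ θ ∂ν) +
          (C₁ : ℝ≥0∞) ^ θ * (ENNReal.ofReal (R ^ θ) * Q * τ univ))) +
          (C₁ : ℝ≥0∞) ^ θ * (S ^ θ * J z)) := by
          refine (ENNReal.rpow_add_le_mul_rpow_add_rpow _ _ hθ.le).trans ?_
          gcongr
          · refine (ENNReal.rpow_add_le_mul_rpow_add_rpow _ _ hθ.le).trans ?_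
            rw [ENNReal.mul_rpow_of_nonneg _ _ hθ0.le]
            gcongr
          · rw [ENNReal.mul_rpow_of_nonneg _ _ hθ0.le, ENNReal.mul_rpow_of_nonneg _ _ hθ0.le,
              ← ENNReal.rpow_mul, one_div_mul_cancel hθ0.ne', ENNReal.rpow_one]
      _ = A * (A * (Q * ∫⁻ x, ‖u x‖ₑ ^ θ ∂ν)) +
          A * (A * ((C₁ : ℝ≥0∞) ^ θ * (ENNReal.ofReal (R ^ θ) * Q))) * τ univ + P₂ * J z := by
          rw [hP₂]; ring
      _ ≤ _ := by
          gcongr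
          rw [mul_add, hP₁]
          gcongr ?_ + ?_
          · calc A * (A * (Q * ∫⁻ x, ‖u x‖ₑ ^ θ ∂ν)) = A * (A * Q) * ∫⁻ x, ‖u x‖ₑ ^ θ ∂ν := by ring
              _ ≤ _ := by gcongr; exact le_self_add
          · gcongr
            exact le_add_self
  calc ∫⁻ z, ‖T z‖ₑ ^ θ ∂H
      ≤ ∫⁻ z, P₁ * ((∫⁻ x, ‖u x‖ₑ ^ θ ∂ν) + τ univ) + P₂ * J z ∂H := lintegral_mono_ae hpt
    _ = P₁ * ((∫⁻ x, ‖u x‖ₑ ^ θ ∂ν) + τ univ) * H univ + P₂ * ∫⁻ z, J z ∂H := by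
        rw [lintegral_add_left measurable_const, lintegral_const, lintegral_const_mul _ hJm]
    _ ≤ P₁ * ((∫⁻ x, ‖u x‖ₑ ^ θ ∂ν) + τ univ) * H univ +
          P₂ * (C₂ * ((∫⁻ x, ‖u x‖ₑ ^ θ ∂ν) + τ univ)) := by
        gcongr
        exact hJint.trans (by gcongr; exact le_add_self)
    _ = _ := by ring

/-- The trace is measurable, being a limit of averages with continuous cutoffs. -/
lemma aestronglyMeasurable_of_traceAt [IsFiniteMeasure ν] [IsFiniteMeasure H]
    (hν : DoublingWith ν K D) (hF : IsCompact F) (hFK : F ⊆ K) (hHF : ∀ᵐ z ∂H, z ∈ F)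
    {u : X → V} (hu : Integrable u ν) {T : X → V} (hT : ∀ᵐ z ∂H, TraceAt ν u z (T z)) :
    AEStronglyMeasurable T H := by
  -- Tents of radius 1/(n+1): unlike averages over balls, weighted averages against them depend
  -- continuously on the center.
  set ψ : ℕ → X → X → ℝ := fun n z x => max 0 (1 - dist z x * (n + 1)) with hψ
  have hψ0 : ∀ n z x, 0 ≤ ψ n z x := fun n z x => le_max_left _ _
  have hψ1 : ∀ n z x, ψ n z x ≤ 1 := fun n z x =>
    max_le zero_le_one (by
      have : 0 ≤ dist z x * ((n : ℝ) + 1) := by positivity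
      linarith)
  have hψn : ∀ n z x, ‖ψ n z x‖ ≤ 1 := fun n z x => by
    rw [Real.norm_of_nonneg (hψ0 n z x)]; exact hψ1 n z x
  have hψc : ∀ n x, Continuous fun z => ψ n z x := fun n x => by fun_prop
  have hψc' : ∀ n z, Continuous fun x => ψ n z x := fun n z => by fun_prop
  have hψint : ∀ n z, Integrable (ψ n z) ν := fun n z =>
    Integrable.of_bound (hψc' n z).measurable.aestronglyMeasurable 1
      (Eventually.of_forall (hψn n z))
  have hψu : ∀ n z, Integrable (fun x => ψ n z x • u x) ν := fun n z =>
    hu.bdd_smul 1 (hψc' n z).measurable.aestronglyMeasurable (Eventually.of_forall (hψn n z))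
  set den : ℕ → X → ℝ := fun n z => ∫ x, ψ n z x ∂ν with hden
  set num : ℕ → X → V := fun n z => ∫ x, ψ n z x • u x ∂ν with hnum
  have hdenc : ∀ n, Continuous (den n) := fun n =>
    continuous_of_dominated (fun z => (hψint n z).1) (fun z => Eventually.of_forall (hψn n z))
      (integrable_const (1 : ℝ)) (Eventually.of_forall (hψc n))
  have hnumc : ∀ n, Continuous (num n) := fun n =>
    continuous_of_dominated (bound := fun x => ‖u x‖) (fun z => (hψu n z).1)
      (fun z => Eventually.of_forall fun x => by
        rw [norm_smul]
        exact mul_le_of_le_one_left (norm_nonneg _) (hψn n z x))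
      hu.norm (Eventually.of_forall fun x => (hψc n x).smul continuous_const)
  have hHr : H.restrict F = H := Measure.restrict_eq_self_of_ae_mem hHF
  refine aestronglyMeasurable_of_tendsto_ae atTop (f := fun n z => (den n z)⁻¹ • num n z)
    (fun n => ?_) ?_
  · have h1 : AEStronglyMeasurable (num n) H := by
      rw [← hHr]
      -- Compactness of F makes the range separable, though X and V need not be.
      exact (hnumc n).continuousOn.aestronglyMeasurable_of_isCompact hF hF.isClosed.measurableSet
    exact (hdenc n).measurable.inv.aestronglyMeasurable.smul h1
  · filter_upwards [hT, hHF] with z hz hzF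
    have hzK := hFK hzF
    have hseq : Tendsto (fun n : ℕ => 1 / ((n : ℝ) + 1)) atTop (𝓝[>] 0) :=
      tendsto_nhdsWithin_iff.2 ⟨tendsto_one_div_add_atTop_nhds_zero_nat,
        Eventually.of_forall fun n => mem_Ioi.2 (by positivity)⟩
    have h2 := ENNReal.Tendsto.const_mul (hz.comp hseq)
      (Or.inr (ENNReal.coe_ne_top (r := 2 * D)))
    rw [mul_zero] at h2
    rw [tendsto_iff_edist_tendsto_0]
    refine tendsto_of_tendsto_of_tendsto_of_le_of_le tendsto_const_nhds h2 (fun _ => bot_le)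
      fun n => ?_
    set r : ℝ := 1 / ((n : ℝ) + 1) with hr
    have hr0 : 0 < r := by positivity
    have hrn : r * (n + 1) = 1 := by rw [hr]; field_simp
    have hψle : ∀ x, ENNReal.ofReal (ψ n z x) ≤ (ball z r).indicator 1 x := by
      intro x
      by_cases hx : x ∈ ball z r
      · rw [indicator_of_mem hx]
        exact ENNReal.ofReal_le_one.2 (hψ1 n z x)
      · rw [indicator_of_notMem hx]
        rw [mem_ball, not_lt, dist_comm] at hx
        have h3 : r * ((n : ℝ) + 1) ≤ dist z x * (n + 1) := by gcongr
        rw [hψ]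
        simp only
        rw [max_eq_left (by linarith), ENNReal.ofReal_zero]
    -- The tent is at least 1/2 on the ball of radius r/2, whose mass is comparable to that of
    -- B(z,r) by doubling.
    have hlow : ν (ball z r) ≤ (2 * D : ℝ≥0) * ENNReal.ofReal (den n z) := by
      rw [hden, ofReal_integral_eq_lintegral_ofReal (hψint n z) (Eventually.of_forall (hψ0 n z))]
      have h3 := hν.le z hzK (r / 2) (by positivity)
      rw [mul_div_cancel₀ _ (two_ne_zero)] at h3
      have h4 : ν (ball z (r / 2)) ≤ 2 * ∫⁻ x, ENNReal.ofReal (ψ n z x) ∂ν := by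
        rw [← setLIntegral_one, ← lintegral_const_mul _ (hψc' n z).measurable.ennreal_ofReal]
        refine (setLIntegral_mono' measurableSet_ball fun x hx => ?_).trans
          (setLIntegral_le_lintegral _ _)
        rw [mem_ball, dist_comm] at hx
        have h5 : dist z x * ((n : ℝ) + 1) ≤ r / 2 * (n + 1) := by gcongr
        have h6 : 1 / 2 ≤ ψ n z x := le_max_of_le_right (by nlinarith)
        calc (1 : ℝ≥0∞) = 2 * ENNReal.ofReal (1 / 2) := by
              rw [← ENNReal.ofReal_ofNat, ← ENNReal.ofReal_mul (by norm_num)]; norm_num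
          _ ≤ _ := by gcongr
      refine h3.trans ?_
      calc D * ν (ball z (r / 2)) ≤ D * (2 * ∫⁻ x, ENNReal.ofReal (ψ n z x) ∂ν) := by gcongr
        _ = _ := by push_cast; ring
    have hball0 := (hν.pos z hzK r hr0).ne'
    have hden0 : 0 < den n z := by
      by_contra h
      rw [ENNReal.ofReal_of_nonpos (not_lt.1 h), mul_zero] at hlow
      exact hball0 (le_antisymm hlow bot_le)
    have hcalc : (den n z)⁻¹ • num n z - T z = (den n z)⁻¹ • ∫ x, ψ n z x • (u x - T z) ∂ν := by
      have h3 : ∫ x, ψ n z x • (u x - T z) ∂ν = num n z - den n z • T z := by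
        simp_rw [smul_sub]
        rw [integral_sub (hψu n z) ((hψint n z).smul_const _), integral_smul_const]
      rw [h3, smul_sub, smul_smul, inv_mul_cancel₀ hden0.ne', one_smul]
    rw [edist_eq_enorm_sub, hcalc, enorm_smul, enorm_inv hden0.ne', Real.enorm_of_nonneg hden0.le]
    simp only [Function.comp]
    rw [setLAverage_eq, mul_comm, ← div_eq_mul_inv]
    have hnumle : ‖∫ x, ψ n z x • (u x - T z) ∂ν‖ₑ ≤ ∫⁻ x in ball z r, ‖u x - T z‖ₑ ∂ν := by
      refine (enorm_integral_le_lintegral_enorm _).trans ?_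
      rw [← lintegral_indicator measurableSet_ball]
      refine lintegral_mono fun x => ?_
      rw [enorm_smul, Real.enorm_of_nonneg (hψ0 n z x)]
      refine (mul_le_mul_left (hψle x) _).trans ?_
      by_cases hx : x ∈ ball z r <;> simp [hx]
    calc _ ≤ (∫⁻ x in ball z r, ‖u x - T z‖ₑ ∂ν) / ENNReal.ofReal (den n z) := by gcongr
      _ ≤ _ := div_le_mul_div_of_le_mul (by simpa using hden0) ENNReal.ofReal_ne_top hball0
          (measure_ne_top _ _) hlow

end TraceBound

/-! ### Replacing weak upper gradients by upper gradients. -/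

section WeakGradients

variable {X : Type*} [MetricSpace X] [MeasurableSpace X] {Ω : Set X} {m : Measure X} {p : ℝ}
  {V : Type*} [NormedAddCommGroup V] {u : X → V} {g : X → ℝ≥0∞}

/-- A family of curves of zero modulus lies in the set where some function of small norm has
infinite line integral. -/
lemma exists_lineIntegral_eq_top (hp : 0 < p) {Γ : Set (RectifiableCurve Ω)}
    (hΓ : modulus p Ω m Γ = 0) {ε : ℝ≥0∞} (hε : ε ≠ 0) :
    ∃ h : X → ℝ≥0∞, Measurable h ∧ (∀ γ ∈ Γ, γ.lineIntegral h = ∞) ∧ gradNorm p Ω m h ≤ ε := by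
  have hεp : ε ^ p ≠ 0 := by
    rw [Ne, ENNReal.rpow_eq_zero_iff]
    rintro (⟨h, -⟩ | ⟨-, h⟩)
    · exact hε h
    · linarith
  obtain ⟨δ, hδ0, hδ⟩ := ENNReal.exists_pos_sum_of_countable' hεp ℕ
  -- The factor n^p forces the pth powers of n h_n to be summable while n h_n has line integral at
  -- least n. For n = 0 the bound δ/0 is ∞ and nothing is asked.
  have hex : ∀ n : ℕ, ∃ h : X → ℝ≥0∞, Measurable h ∧ (∀ γ ∈ Γ, 1 ≤ γ.lineIntegral h) ∧
      (n : ℝ≥0∞) ^ p * ∫⁻ x in Ω, h x ^ p ∂m ≤ δ n := by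
    intro n
    have hnp : (n : ℝ≥0∞) ^ p ≠ ∞ := ENNReal.rpow_ne_top_of_nonneg hp.le (ENNReal.natCast_ne_top n)
    have hlt : modulus p Ω m Γ < δ n / (n : ℝ≥0∞) ^ p := by
      rw [hΓ]
      exact ENNReal.div_pos (hδ0 n).ne' hnp
    simp only [modulus, iInf_lt_iff] at hlt
    obtain ⟨h, hm, ha, hlt⟩ := hlt
    refine ⟨h, hm, ha, ?_⟩
    calc (n : ℝ≥0∞) ^ p * ∫⁻ x in Ω, h x ^ p ∂m ≤ (n : ℝ≥0∞) ^ p * (δ n / (n : ℝ≥0∞) ^ p) := by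
          gcongr
      _ ≤ δ n := ENNReal.mul_div_le
  choose h hm ha hle using hex
  have hm' : ∀ n : ℕ, Measurable fun x => ((n : ℝ≥0∞) * h n x) ^ p := fun n =>
    ((hm n).const_mul _).pow_const p
  refine ⟨fun x => (∑' n : ℕ, ((n : ℝ≥0∞) * h n x) ^ p) ^ (1 / p),
    (Measurable.tsum hm').pow_const _, fun γ hγ => ?_, ?_⟩
  · refine ENNReal.eq_top_of_forall_nnreal_le fun r => ?_
    obtain ⟨n, hn⟩ := exists_nat_ge r
    calc (r : ℝ≥0∞) ≤ n := by exact_mod_cast hn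
      _ ≤ n * γ.lineIntegral (h n) := le_mul_of_one_le_right bot_le (ha n γ hγ)
      _ ≤ γ.lineIntegral fun x => n * h n x := lintegral_const_mul_le _ _
      _ ≤ _ := by
          refine lintegral_mono fun t => ?_
          rw [one_div, ENNReal.le_rpow_inv_iff hp]
          exact ENNReal.le_tsum (f := fun n : ℕ => ((n : ℝ≥0∞) * h n (γ.arcLength t)) ^ p) n
  · unfold gradNorm
    simp only [← ENNReal.rpow_mul, one_div_mul_cancel hp.ne', ENNReal.rpow_one]
    rw [one_div, ENNReal.rpow_inv_le_iff hp, lintegral_tsum fun n => (hm' n).aemeasurable]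
    refine le_trans (ENNReal.tsum_le_tsum fun n => ?_) hδ.le
    simp_rw [ENNReal.mul_rpow_of_nonneg _ _ hp.le]
    rw [lintegral_const_mul _ ((hm n).pow_const p)]
    exact hle n

/-- Adding a function of small norm with infinite line integral along the exceptional curves makes
the inequality trivial there. -/
lemma IsWeakUpperGradient.exists_isUpperGradient (hp : 1 ≤ p)
    (hg : IsWeakUpperGradient p Ω m u g) {ε : ℝ≥0∞} (hε : ε ≠ 0) :
    ∃ g', IsUpperGradient Ω u g' ∧ gradNorm p Ω m g' ≤ gradNorm p Ω m g + ε := by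
  obtain ⟨h, hm, hΓ, hle⟩ := exists_lineIntegral_eq_top (by linarith) hg.2 hε
  refine ⟨g + h, ⟨hg.1.add hm, fun γ => ?_⟩,
    (gradNorm_add hp hg.1 hm).trans (add_le_add le_rfl hle)⟩
  by_cases hγ : UpperGradientIneq u g γ
  · exact hγ.trans (lintegral_mono fun t => le_self_add)
  · have : γ.lineIntegral (g + h) = ∞ := by
      rw [eq_top_iff, ← hΓ γ hγ]
      exact lintegral_mono fun t => le_add_self
    rw [UpperGradientIneq, this]
    exact le_top

lemma IsUpperGradient.dual [NormedSpace ℝ V] (hg : IsUpperGradient Ω u g) {φ : StrongDual ℝ V}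
    (hφ : ‖φ‖ ≤ 1) : IsUpperGradient Ω (fun x => φ (u x)) g := by
  refine ⟨hg.1, fun γ => le_trans ?_ (hg.2 γ)⟩
  rw [← map_sub, enorm_le_iff_norm_le]
  exact (φ.le_opNorm _).trans (mul_le_of_le_one_left (norm_nonneg _) hφ)

end WeakGradients

/-! ### Translating the assumptions on the domain. -/

section Setting

variable {X : Type*} [MetricSpace X] [MeasurableSpace X] [BorelSpace X] {μ H : Measure X}
  {Ω : Set X} {θ : ℝ} {ω : ℝ → ℝ}
  {V : Type*} [NormedAddCommGroup V] [NormedSpace ℝ V] {u v : X → V}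

lemma traceAt_restrict_iff {z : X} {a : V} :
    TraceAt (μ.restrict Ω) u z a ↔ IsTraceAt μ Ω u z a := by
  simp only [TraceAt, IsTraceAt, Measure.restrict_restrict measurableSet_ball]

lemma smul_restrict_le_restrict_withDensity {B : Set X} (hB : MeasurableSet B) {ρ : X → ℝ≥0∞}
    {a : ℝ≥0∞} (h : ∀ x ∈ B, a ≤ ρ x) : a • μ.restrict B ≤ (μ.withDensity ρ).restrict B := by
  refine Measure.le_iff.2 fun s hs => ?_
  rw [Measure.smul_apply, Measure.restrict_apply hs, Measure.restrict_apply hs,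
    withDensity_apply _ (hs.inter hB), smul_eq_mul, ← setLIntegral_const]
  exact setLIntegral_mono' (hs.inter hB) fun x hx => h x hx.2

lemma infDist_frontier_pos (hΩ : IsOpen Ω) (hne : (frontier Ω).Nonempty) {x : X} (hx : x ∈ Ω) :
    0 < infDist x (frontier Ω) :=
  (isClosed_frontier.notMem_iff_infDist_pos hne).1 fun h => hΩ.inter_frontier_eq.le ⟨hx, h⟩

lemma restrict_le_weightedMeasure (hΩ : IsOpen Ω) (hne : (frontier Ω).Nonempty)
    (hω1 : ∀ t, 0 < t → 1 ≤ ω t) :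
    μ.restrict Ω ≤ (weightedMeasure ω μ Ω).restrict Ω := by
  have h := smul_restrict_le_restrict_withDensity (μ := μ) (a := 1) hΩ.measurableSet
    (ρ := fun x => ENNReal.ofReal (ω (infDist x (frontier Ω)))) fun x hx =>
      ENNReal.one_le_ofReal.2 (hω1 _ (infDist_frontier_pos hΩ hne hx))
  rwa [one_smul] at h

/-- Points of Ω within t of a boundary point have boundary distance at most t, and ω is
non-increasing. -/
lemma dominatesEnergy_weightedMeasure (hΩ : IsOpen Ω) (hne : (frontier Ω).Nonempty)
    (hω : AntitoneOn ω (Ioi 0)) (g : X → ℝ≥0∞) :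
    DominatesEnergy (μ.restrict Ω)
      (((weightedMeasure ω μ Ω).restrict Ω).withDensity fun x => g x ^ θ) (frontier Ω) θ ω g := by
  intro z hz t ht A hA hAz
  rw [withDensity_apply _ hA, ← smul_eq_mul, ← lintegral_smul_measure,
    Measure.restrict_restrict hA, Measure.restrict_restrict hA]
  refine lintegral_mono' (smul_restrict_le_restrict_withDensity (hA.inter hΩ.measurableSet)
    fun x hx => ENNReal.ofReal_le_ofReal ?_) le_rfl
  refine hω (mem_Ioi.2 (infDist_frontier_pos hΩ hne hx.2)) (mem_Ioi.2 ht) ?_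
  exact (infDist_le_dist_of_mem hz).trans (le_of_lt (hAz hx.1))

lemma IsDoublingOn.exists_doublingWith (hd : IsDoublingOn μ Ω) (hΩ : IsOpen Ω) :
    ∃ D : ℝ≥0, DoublingWith (μ.restrict Ω) (closure Ω) D := by
  obtain ⟨D, hD1, hD⟩ := hd
  refine ⟨D, hD1, ?_, fun x hx r hr => ?_, fun x hx r hr => ?_⟩
  · filter_upwards [ae_restrict_mem hΩ.measurableSet] with x hx using subset_closure hx
  · rw [Measure.restrict_apply measurableSet_ball]
    have := (hD x hx (r / 2) (by positivity)).1
    rwa [mul_div_cancel₀ _ (two_ne_zero)] at this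
  · rw [Measure.restrict_apply measurableSet_ball, Measure.restrict_apply measurableSet_ball]
    exact (hD x hx r hr).2.1

lemma IsDoublingOn.measure_lt_top (hd : IsDoublingOn μ Ω) (hb : Bornology.IsBounded Ω)
    (hne : Ω.Nonempty) : μ Ω < ∞ := by
  obtain ⟨D, hD1, hD⟩ := hd
  obtain ⟨a, ha⟩ := hne
  obtain ⟨r, hr⟩ := hb.subset_ball a
  have h := (hD a (subset_closure ha) (max r 1) (by positivity))
  refine lt_of_le_of_lt ?_ (h.2.1.trans_lt h.2.2)
  refine measure_mono (subset_inter (hr.trans (ball_subset_ball ?_)) Subset.rfl)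
  have h1 := le_max_left r 1
  have h2 := le_max_right r 1
  linarith

lemma SupportsLocalPoincare.exists_poincareOn (hP : SupportsLocalPoincare θ μ Ω) :
    ∃ (C : ℝ≥0) (lam : ℝ), 1 ≤ lam ∧ ∀ (u : X → ℝ) (g : X → ℝ≥0∞),
      Integrable u (μ.restrict Ω) → IsUpperGradient Ω u g →
      PoincareOn (μ.restrict Ω) Ω θ C lam u g := by
  obtain ⟨C, lam, hC, hlam, h⟩ := hP
  refine ⟨C.toNNReal, lam, hlam, fun u g hu hg x hx r hr => ?_⟩
  simp only [Measure.restrict_restrict measurableSet_ball]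
  refine (h x hx r hr u ?_ ?_ g hg).trans (le_of_eq ?_)
  · exact IntegrableOn.locallyIntegrableOn hu
  · exact IntegrableOn.mono_set hu inter_subset_right
  · rw [ENNReal.ofReal_mul hC.le]
    rfl

end Setting

/-! ### The a priori estimate for traces of Sobolev functions. -/

section TraceOperator

variable {X : Type*} [MetricSpace X] [MeasurableSpace X] [BorelSpace X] {μ ν H : Measure X}
  {Ω K F : Set X} {θ : ℝ} {ω : ℝ → ℝ} {D : ℝ≥0}
  {V : Type*} [NormedAddCommGroup V] [NormedSpace ℝ V]

/-- R is capped at 1/3 so that the radii 3 r_k stay in the range (0,1] of the integral condition; 4R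
≤ diam Ω keeps 6R below the regularity threshold 2 diam Ω. -/
lemma HasChains.of_isJohn (hJ : IsJohn Ω) (hΩ : IsOpen Ω) (hne : (frontier Ω).Nonempty)
    (hb : Bornology.IsBounded Ω) :
    ∃ c R : ℝ, 0 < c ∧ c ≤ 1 ∧ 0 < R ∧ 3 * R ≤ 1 ∧ 4 * R ≤ diam Ω ∧
      HasChains (closure Ω) (frontier Ω) Ωᶜ c R := by
  obtain ⟨c, R, hc, hc1, hR, ha, hch⟩ := hJ.exists_chain hΩ hne
  refine ⟨c, min R (1 / 3), hc, hc1, by positivity, ?_, ?_, fun z hz s hs hsR => ?_⟩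
  · linarith [min_le_right R (1 / 3)]
  · obtain ⟨z, hz⟩ := hne
    obtain ⟨a, haΩ, haz⟩ := ha z hz
    rw [← Metric.diam_closure]
    refine le_trans ?_ (haz.trans (dist_le_diam_of_mem hb.closure (subset_closure haΩ)
      (frontier_subset_closure hz)))
    linarith [min_le_left R (1 / 3)]
  · obtain ⟨y, hy, hyd⟩ := hch z hz s hs (hsR.trans (min_le_left _ _))
    have hsub : Icc s (min R (1 / 3)) ⊆ Icc s R := Icc_subset_Icc le_rfl (min_le_left _ _)
    exact ⟨y, fun t ht => ⟨subset_closure (hy t (hsub ht)).1, (hy t (hsub ht)).2⟩,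
      fun t ht t' ht' => hyd t (hsub ht) t' (hsub ht')⟩

lemma IsUpperCodimRegular.codimWith (hH : IsUpperCodimRegular θ μ H Ω (frontier Ω)) :
    ∃ Ch : ℝ≥0, CodimWith (μ.restrict Ω) (H.restrict (frontier Ω)) (frontier Ω) θ Ch
      (2 * diam Ω) := by
  obtain ⟨C, hC⟩ := hH
  refine ⟨C, fun z hz r hr hrR => ?_⟩
  rw [Measure.restrict_apply measurableSet_ball, Measure.restrict_apply measurableSet_ball]
  exact hC z hz r hr hrR

/-- A single ball of radius 3/2 diam Ω, an admissible scale, covers F. -/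
lemma CodimWith.isFiniteMeasure_restrict [IsFiniteMeasure ν] {Ch : ℝ≥0}
    (hH : CodimWith ν (H.restrict F) F θ Ch (2 * diam Ω)) (hne : F.Nonempty)
    (hd : 0 < diam Ω) (hb : Bornology.IsBounded Ω) (hF : F ⊆ closure Ω) :
    IsFiniteMeasure (H.restrict F) := by
  obtain ⟨z, hz⟩ := hne
  have h := hH z hz (3 / 2 * diam Ω) (by positivity) (by linarith)
  have hsub : F ⊆ ball z (3 / 2 * diam Ω) := by
    intro x hx
    have h1 := dist_le_diam_of_mem hb.closure (hF hx) (hF hz)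
    rw [Metric.diam_closure] at h1
    rw [mem_ball]
    linarith
  constructor
  rw [Measure.restrict_apply_univ]
  rw [Measure.restrict_apply measurableSet_ball, inter_eq_right.2 hsub] at h
  refine h.trans_lt (ENNReal.mul_lt_top ENNReal.coe_lt_top (ENNReal.div_lt_top
    (measure_ne_top _ _) ?_))
  rw [Ne, ENNReal.ofReal_eq_zero, not_le]
  positivity

lemma TraceAt.add {u v : X → V} (hu : AEStronglyMeasurable u ν) {z : X} {a b : V}
    (ha : TraceAt ν u z a) (hb : TraceAt ν v z b) : TraceAt ν (u + v) z (a + b) := by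
  have h := Tendsto.add ha hb
  rw [add_zero] at h
  refine tendsto_of_tendsto_of_tendsto_of_le_of_le tendsto_const_nhds h (fun _ => bot_le)
    fun r => ?_
  simp only
  rw [← setLAverage_add (f := fun x => ‖u x - a‖ₑ) (hu.sub aestronglyMeasurable_const).enorm]
  refine laverage_mono_ae (Eventually.of_forall fun x => ?_)
  have e : (u + v) x - (a + b) = (u x - a) + (v x - b) := by simp only [Pi.add_apply]; abel
  simp only [e]
  exact enorm_add_le _ _

lemma TraceAt.smul {u : X → V} {z : X} {a : V} (c : ℝ) (ha : TraceAt ν u z a) :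
    TraceAt ν (c • u) z (c • a) := by
  have h := ENNReal.Tendsto.const_mul ha (Or.inr (enorm_ne_top (x := c)))
  rw [mul_zero] at h
  refine h.congr fun r => ?_
  rw [setLAverage_eq', setLAverage_eq', ← lintegral_const_mul' _ _ enorm_ne_top]
  simp only [Pi.smul_apply, ← smul_sub, enorm_smul]

variable [CompleteSpace V] [hθ : Fact (1 < θ)]

lemma memLp_restrict_of_weighted {m : Measure X} (hm : μ.restrict Ω ≤ m.restrict Ω)
    (u : PreSobolev θ Ω V m) : MemLp u.fn (ENNReal.ofReal θ) (μ.restrict Ω) :=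
  u.memLp.mono_measure hm

lemma lintegral_rpow_eq_eLpNorm_rpow (hθ0 : 0 < θ) (u : X → V) :
    ∫⁻ x, ‖u x‖ₑ ^ θ ∂ν = eLpNorm u (ENNReal.ofReal θ) ν ^ θ := by
  rw [eLpNorm_eq_lintegral_rpow_enorm_toReal (by simpa using hθ0) ENNReal.ofReal_ne_top,
    ENNReal.toReal_ofReal hθ0.le, ← ENNReal.rpow_mul, one_div_mul_cancel hθ0.ne',
    ENNReal.rpow_one]

lemma exists_eLpNorm_trace_le (hΩ : IsBoundedDomain Ω) (hne : (frontier Ω).Nonempty)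
    (hadm : IsWeaklyAdmissible θ μ H Ω) (hJohn : IsJohn Ω) (hcpt : IsCompact (closure Ω))
    (hω_anti : AntitoneOn ω (Ioi 0)) (hω_one : ∀ t, 0 < t → 1 ≤ ω t)
    (hω_int : ∫⁻ t in Ioo (0 : ℝ) 1, ENNReal.ofReal (t⁻¹ * ω t ^ (-1 / (θ - 1))) < ∞) :
    ∃ M : ℝ≥0, ∀ u : PreSobolev θ Ω V (weightedMeasure ω μ Ω),
      (∀ᵐ z ∂(H.restrict (frontier Ω)), ∃ v, TraceAt (μ.restrict Ω) u.fn z v) ∧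
      ∀ T : X → V, (∀ᵐ z ∂(H.restrict (frontier Ω)), TraceAt (μ.restrict Ω) u.fn z (T z)) →
        eLpNorm T (ENNReal.ofReal θ) (H.restrict (frontier Ω)) ≤
          M * (eLpNorm u.fn (ENNReal.ofReal θ) ((weightedMeasure ω μ Ω).restrict Ω) +
            dirichletSeminorm θ Ω (weightedMeasure ω μ Ω) u.fn) := by
  obtain ⟨hΩo, hΩc, hΩb⟩ := hΩ
  have hθ1 : 1 < θ := hθ.out
  have hθ0 : 0 < θ := by linarith
  have hfin : IsFiniteMeasure (μ.restrict Ω) :=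
    ⟨by rw [Measure.restrict_apply_univ]
        exact hadm.doubling.measure_lt_top hΩb hΩc.nonempty⟩
  obtain ⟨D, hD⟩ := hadm.doubling.exists_doublingWith hΩo
  obtain ⟨c, R, hc, hc1, hR, hR3, hRd, hch⟩ := HasChains.of_isJohn hJohn hΩo hne hΩb
  obtain ⟨Ch, hCh⟩ := hadm.codim.codimWith
  have hHfin : IsFiniteMeasure (H.restrict (frontier Ω)) :=
    hCh.isFiniteMeasure_restrict hne (by linarith) hΩb frontier_subset_closure
  obtain ⟨C, lam, hlam, hP⟩ := hadm.poincare.exists_poincareOn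
  have hΩae : ∀ᵐ x ∂(μ.restrict Ω), x ∈ Ω := ae_restrict_mem hΩo.measurableSet
  obtain ⟨C', hC'⟩ := hD.exists_poincareOn_of_dual (V := V) hcpt subset_closure hΩae hθ1.le hlam C
  have hFG : frontier Ω ⊆ Ωᶜ := fun z hz hzΩ => hΩo.inter_frontier_eq.le ⟨hzΩ, hz⟩
  -- The vector-valued Poincaré inequality has dilation 5λ, which replaces λ here.
  obtain ⟨σ, hσ⟩ : ∃ σ : ℝ, σ = c / (4 * (5 * lam)) := ⟨_, rfl⟩
  have hσ0 : 0 < σ := by rw [hσ]; positivity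
  have hσc : 4 * (5 * lam) * σ = c := by rw [hσ]; field_simp
  have hσ1 : σ < 1 := by nlinarith
  have htail : weightTail ω θ R (1 - σ) 0 ≠ ∞ := by
    have h := tsum_weight_lt_top hω_anti hω_one (α := 1 / (θ - 1))
      (div_nonneg zero_le_one (by linarith)) (by simpa only [neg_div] using hω_int)
      (p := 1 - σ) (R := 3 * R) (by linarith) (by linarith) (by positivity) hR3
    rw [weightTail]
    simpa only [neg_div, mul_assoc, add_zero] using h.ne
  obtain ⟨C'', hC''t, hC''⟩ := exists_trace_bound (V := V) (G := Ωᶜ) hD hcpt isClosed_frontier hne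
    frontier_subset_closure hFG (ae_restrict_mem isClosed_frontier.measurableSet)
    (by rw [Measure.restrict_apply isClosed_frontier.measurableSet, inter_comm,
          hΩo.inter_frontier_eq, measure_empty])
    hCh hch hR (by linarith) C' hc hc1 (by linarith : 1 ≤ 5 * lam) hθ1 hω_one hσ0 hσ1 hσc htail
  set m := weightedMeasure ω μ Ω with hm
  have hle : μ.restrict Ω ≤ m.restrict Ω := restrict_le_weightedMeasure hΩo hne hω_one
  -- The general bound is applied with the weighted energy measure τ = g^θ ρ μ on Ω.
  have hmain : ∀ (u : PreSobolev θ Ω V m) (g : X → ℝ≥0∞), IsUpperGradient Ω u.fn g →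
      gradNorm θ Ω m g < ∞ →
      (∀ᵐ z ∂(H.restrict (frontier Ω)), ∃ v, TraceAt (μ.restrict Ω) u.fn z v) ∧
      ∀ T : X → V, (∀ᵐ z ∂(H.restrict (frontier Ω)), TraceAt (μ.restrict Ω) u.fn z (T z)) →
        ∫⁻ z, ‖T z‖ₑ ^ θ ∂(H.restrict (frontier Ω)) ≤
          C'' * (eLpNorm u.fn (ENNReal.ofReal θ) (m.restrict Ω) ^ θ + gradNorm θ Ω m g ^ θ) := by
    intro u g hg hgt
    have hgm : Measurable g := hg.1
    have hτ : ((m.restrict Ω).withDensity fun x => g x ^ θ) univ = gradNorm θ Ω m g ^ θ := by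
      rw [withDensity_apply _ MeasurableSet.univ, Measure.restrict_univ, gradNorm,
        ← ENNReal.rpow_mul, one_div_mul_cancel hθ0.ne', ENNReal.rpow_one]
    have hτfin : IsFiniteMeasure ((m.restrict Ω).withDensity fun x => g x ^ θ) :=
      ⟨by rw [hτ]; exact ENNReal.rpow_lt_top_of_nonneg hθ0.le hgt.ne⟩
    have hτK : ∀ᵐ x ∂((m.restrict Ω).withDensity fun x => g x ^ θ), x ∈ closure Ω :=
      withDensity_absolutelyContinuous _ _ |>.ae_le
        ((ae_restrict_mem hΩo.measurableSet).mono fun x hx => subset_closure hx)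
    have hui : Integrable u.fn (μ.restrict Ω) :=
      (memLp_restrict_of_weighted hle u).integrable (ENNReal.one_le_ofReal.2 hθ1.le)
    obtain ⟨h1, h2⟩ := hC'' u.fn g _ hτfin hτK hui
      (hC' u.fn g hui hgm fun φ hφ => hP _ g (φ.integrable_comp hui) (hg.dual hφ))
      (dominatesEnergy_weightedMeasure hΩo hne hω_anti g)
      (by
        rw [withDensity_apply _ MeasurableSet.univ, Measure.restrict_univ]
        exact lintegral_mono' hle le_rfl)
    refine ⟨h1, fun T hT => (h2 T hT).trans ?_⟩
    rw [hτ, ← lintegral_rpow_eq_eLpNorm_rpow hθ0]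
    gcongr
  have hM0 : (C'' * 2) ^ (1 / θ) ≠ ∞ := ENNReal.rpow_ne_top_of_nonneg (by positivity)
    (ENNReal.mul_ne_top hC''t (by simp))
  refine ⟨((C'' * 2) ^ (1 / θ)).toNNReal, fun u => ⟨?_, fun T hT => ?_⟩⟩
  · obtain ⟨_, g, hg, hgt⟩ := u.2
    exact (hmain u g hg hgt).1
  rw [ENNReal.coe_toNNReal hM0]
  have hbound : ∀ g : X → ℝ≥0∞, IsUpperGradient Ω u.fn g →
      eLpNorm T (ENNReal.ofReal θ) (H.restrict (frontier Ω)) ≤ (C'' * 2) ^ (1 / θ) *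
        (eLpNorm u.fn (ENNReal.ofReal θ) (m.restrict Ω) + gradNorm θ Ω m g) := by
    intro g hg
    rcases eq_or_ne (gradNorm θ Ω m g) ∞ with htop | hgt
    -- As 0 · ∞ = 0, the bound is not vacuous when C'' = 0; another gradient, of finite norm, then
    -- shows that T vanishes.
    · rcases eq_or_ne C'' 0 with h0 | h0
      · obtain ⟨_, g', hg', hgt'⟩ := u.2
        have h := (hmain u g' hg' hgt').2 T hT
        rw [h0, zero_mul, lintegral_rpow_eq_eLpNorm_rpow hθ0, nonpos_iff_eq_zero,
          ENNReal.rpow_eq_zero_iff_of_pos hθ0] at h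
        rw [h]
        exact bot_le
      · rw [htop, add_top, ENNReal.mul_top]
        · exact le_top
        · rw [Ne, ENNReal.rpow_eq_zero_iff_of_pos (by positivity)]
          exact mul_ne_zero h0 two_ne_zero
    · have h := (hmain u g hg (lt_top_iff_ne_top.2 hgt)).2 T hT
      rw [lintegral_rpow_eq_eLpNorm_rpow hθ0] at h
      set N := eLpNorm u.fn (ENNReal.ofReal θ) (m.restrict Ω) + gradNorm θ Ω m g with hN
      have h' : eLpNorm T (ENNReal.ofReal θ) (H.restrict (frontier Ω)) ^ θ ≤ C'' * 2 * N ^ θ := by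
        refine h.trans ?_
        rw [mul_assoc, two_mul]
        gcongr
        · exact le_self_add
        · exact le_add_self
      rw [← ENNReal.le_rpow_inv_iff hθ0, ENNReal.mul_rpow_of_nonneg _ _ (by positivity),
        ← ENNReal.rpow_mul, mul_inv_cancel₀ hθ0.ne', ENNReal.rpow_one] at h'
      rwa [one_div]
  set U := eLpNorm u.fn (ENNReal.ofReal θ) (m.restrict Ω)
  set d := dirichletSeminorm θ Ω m u.fn with hd
  have hdt : d ≠ ∞ := u.dirichlet_ne_top
  -- One error 1/n for nearly attaining the infimum over weak gradients, another for making the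
  -- gradient a true one.
  have happrox : ∀ n : ℕ, eLpNorm T (ENNReal.ofReal θ) (H.restrict (frontier Ω)) ≤
      (C'' * 2) ^ (1 / θ) * (U + (d + (n : ℝ≥0∞)⁻¹ + (n : ℝ≥0∞)⁻¹)) := by
    intro n
    have hn : (n : ℝ≥0∞)⁻¹ ≠ 0 := ENNReal.inv_ne_zero.2 (ENNReal.natCast_ne_top n)
    have hlt : dirichletSeminorm θ Ω m u.fn < d + (n : ℝ≥0∞)⁻¹ := ENNReal.lt_add_right hdt hn
    simp only [dirichletSeminorm, iInf_lt_iff] at hlt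
    obtain ⟨g, hg, hgd⟩ := hlt
    obtain ⟨g', hg', hgg'⟩ := hg.exists_isUpperGradient hθ1.le hn
    refine (hbound g' hg').trans ?_
    gcongr
    exact hgg'.trans (by gcongr)
  have hlim : Tendsto (fun n : ℕ => (C'' * 2) ^ (1 / θ) *
      (U + (d + (n : ℝ≥0∞)⁻¹ + (n : ℝ≥0∞)⁻¹))) atTop (𝓝 ((C'' * 2) ^ (1 / θ) * (U + (d + 0 + 0)))) :=
    ENNReal.Tendsto.const_mul (tendsto_const_nhds.add ((tendsto_const_nhds.add
      ENNReal.tendsto_inv_nat_nhds_zero).add ENNReal.tendsto_inv_nat_nhds_zero)) (Or.inr hM0)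
  have h := ge_of_tendsto' hlim happrox
  rwa [add_zero, add_zero] at h

end TraceOperator

/-! ### Assembling the bounded linear operator. -/

section Construction

variable {X : Type*} [MetricSpace X] [MeasurableSpace X] [BorelSpace X] {ν H : Measure X}
  {Ω : Set X} {p : ℝ} {V : Type*} [NormedAddCommGroup V] [NormedSpace ℝ V]

open Classical in
/-- The trace function of `u`, equal to zero where `u` has no trace. -/
noncomputable def traceFun (ν : Measure X) (u : X → V) (z : X) : V :=
  if h : ∃ v, TraceAt ν u z v then h.choose else 0

lemma traceAt_traceFun {u : X → V} {z : X} (h : ∃ v, TraceAt ν u z v) :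
    TraceAt ν u z (traceFun ν u z) := by
  rw [traceFun, dif_pos h]
  exact h.choose_spec

/-- A bounded linear trace operator, from existence, uniqueness, measurability and bounds. -/
lemma exists_traceOperator [Fact (1 ≤ ENNReal.ofReal p)] {m : Measure X} {M : ℝ≥0}
    (hex : ∀ u : PreSobolev p Ω V m, ∀ᵐ z ∂H, ∃ v, TraceAt ν u.fn z v)
    (huniq : ∀ u : PreSobolev p Ω V m, ∀ᵐ z ∂H, ∀ v w, TraceAt ν u.fn z v → TraceAt ν u.fn z w →
      v = w)
    (hmeas : ∀ u : PreSobolev p Ω V m, AEStronglyMeasurable u.fn ν)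
    (htr : ∀ (u : PreSobolev p Ω V m) (T : X → V), (∀ᵐ z ∂H, TraceAt ν u.fn z (T z)) →
      AEStronglyMeasurable T H ∧ eLpNorm T (ENNReal.ofReal p) H ≤
        M * (eLpNorm u.fn (ENNReal.ofReal p) (m.restrict Ω) + dirichletSeminorm p Ω m u.fn)) :
    ∃ T : Sobolev p Ω V m →L[ℝ] Lp V (ENNReal.ofReal p) H, ∀ u : PreSobolev p Ω V m,
      ∀ᵐ z ∂H, TraceAt ν u.fn z (T (SeparationQuotient.mk u) z) := by
  have htf : ∀ u : PreSobolev p Ω V m, ∀ᵐ z ∂H, TraceAt ν u.fn z (traceFun ν u.fn z) :=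
    fun u => (hex u).mono fun z hz => traceAt_traceFun hz
  have hnt : ∀ u : PreSobolev p Ω V m, M * (eLpNorm u.fn (ENNReal.ofReal p) (m.restrict Ω) +
      dirichletSeminorm p Ω m u.fn) ≠ ∞ := fun u =>
    ENNReal.mul_ne_top ENNReal.coe_ne_top (ENNReal.add_ne_top.2 ⟨u.memLp.2.ne, u.dirichlet_ne_top⟩)
  have hmem : ∀ u : PreSobolev p Ω V m, MemLp (traceFun ν u.fn) (ENNReal.ofReal p) H := fun u =>
    ⟨(htr u _ (htf u)).1, (htr u _ (htf u)).2.trans_lt (hnt u).lt_top⟩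
  -- Traces are chosen pointwise, so additivity and homogeneity hold only almost everywhere, by
  -- uniqueness.
  let T₀ : PreSobolev p Ω V m →ₗ[ℝ] Lp V (ENNReal.ofReal p) H :=
    { toFun := fun u => (hmem u).toLp
      map_add' := fun u v => by
        rw [← MemLp.toLp_add, MemLp.toLp_eq_toLp_iff]
        filter_upwards [htf u, htf v, htf (u + v), huniq (u + v)] with z h1 h2 h3 h4
        exact h4 _ _ h3 (h1.add (hmeas u) h2)
      map_smul' := fun c u => by
        rw [RingHom.id_apply, ← MemLp.toLp_const_smul, MemLp.toLp_eq_toLp_iff]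
        filter_upwards [htf u, htf (c • u), huniq (c • u)] with z h1 h3 h4
        exact h4 _ _ h3 (h1.smul c) }
  let T₁ : PreSobolev p Ω V m →L[ℝ] Lp V (ENNReal.ofReal p) H := T₀.mkContinuous M fun u => by
    change ‖(hmem u).toLp‖ ≤ M * ‖u‖
    rw [Lp.norm_toLp, PreSobolev.norm_def,
      ← ENNReal.toReal_add u.memLp.2.ne u.dirichlet_ne_top, ← ENNReal.coe_toReal,
      ← ENNReal.toReal_mul]
    exact ENNReal.toReal_mono (hnt u) (htr u _ (htf u)).2
  -- A continuous map sends inseparable functions to inseparable, hence equal, elements of L^p.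
  refine ⟨SeparationQuotient.liftCLM T₁ fun u v huv => (huv.map T₁.continuous).eq, fun u => ?_⟩
  filter_upwards [htf u, (hmem u).coeFn_toLp] with z h1 h2
  rw [SeparationQuotient.liftCLM_mk]
  change TraceAt ν u.fn z (((hmem u).toLp : Lp V (ENNReal.ofReal p) H) z)
  rwa [h2]

end Construction

end BorderlineTrace

/-- Boundedness and linearity of the trace operator on John domains in the borderline case. -/
theorem theorem5p3 {X : Type*} [MetricSpace X] [CompleteSpace X] [MeasurableSpace X]
    [BorelSpace X] {V : Type*} [NormedAddCommGroup V] [NormedSpace ℝ V] [CompleteSpace V]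
    (μ H : Measure X) (Ω : Set X) (hΩ : BorderlineTrace.IsBoundedDomain Ω)
    (hH : SigmaFinite (H.restrict (frontier Ω)))
    (θ : ℝ) [hθ : Fact (1 < θ)] (hadm : BorderlineTrace.IsWeaklyAdmissible θ μ H Ω)
    (hJohn : BorderlineTrace.IsJohn Ω) (hcpt : IsCompact (closure Ω))
    (ω : ℝ → ℝ) (hω_anti : AntitoneOn ω (Ioi 0)) (hω_one : ∀ t, 0 < t → 1 ≤ ω t)
    (hω_int : ∫⁻ t in Ioo (0 : ℝ) 1, ENNReal.ofReal (t⁻¹ * ω t ^ (-1 / (θ - 1))) < ∞) :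
    ∃ T : BorderlineTrace.Sobolev θ Ω V (BorderlineTrace.weightedMeasure ω μ Ω) →L[ℝ]
        Lp V (ENNReal.ofReal θ) (H.restrict (frontier Ω)),
      ∀ u : BorderlineTrace.PreSobolev θ Ω V (BorderlineTrace.weightedMeasure ω μ Ω),
        ∀ᵐ z ∂(H.restrict (frontier Ω)),
          BorderlineTrace.IsTraceAt μ Ω u.fn z (T (SeparationQuotient.mk u) z) := by
  -- With empty boundary the target measure is zero and any operator will do; otherwise distances to
  -- the boundary are positive on Ω and the estimates apply.
  rcases (frontier Ω).eq_empty_or_nonempty with hempty | hne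
  · refine ⟨0, fun u => ?_⟩
    rw [hempty, Measure.restrict_empty]
    simp
  have hθ1 : 1 < θ := hθ.out
  have hle : μ.restrict Ω ≤ (BorderlineTrace.weightedMeasure ω μ Ω).restrict Ω :=
    BorderlineTrace.restrict_le_weightedMeasure hΩ.1 hne hω_one
  have hfin : IsFiniteMeasure (μ.restrict Ω) :=
    ⟨by rw [Measure.restrict_apply_univ]
        exact hadm.doubling.measure_lt_top hΩ.2.2 hΩ.2.1.nonempty⟩
  obtain ⟨D, hD⟩ := hadm.doubling.exists_doublingWith hΩ.1
  have hfr : ∀ᵐ z ∂(H.restrict (frontier Ω)), z ∈ frontier Ω :=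
    ae_restrict_mem isClosed_frontier.measurableSet
  have hfrK : IsCompact (frontier Ω) := hcpt.of_isClosed_subset isClosed_frontier
    frontier_subset_closure
  obtain ⟨Ch, hCh⟩ := hadm.codim.codimWith
  obtain ⟨_, R, _, _, hR, _, hRd, _⟩ := BorderlineTrace.HasChains.of_isJohn hJohn hΩ.1 hne hΩ.2.2
  have hHfin : IsFiniteMeasure (H.restrict (frontier Ω)) :=
    hCh.isFiniteMeasure_restrict hne (by linarith) hΩ.2.2 frontier_subset_closure
  obtain ⟨M, hM⟩ := BorderlineTrace.exists_eLpNorm_trace_le (V := V) hΩ hne hadm hJohn hcpt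
    hω_anti hω_one hω_int
  have hint : ∀ u : BorderlineTrace.PreSobolev θ Ω V (BorderlineTrace.weightedMeasure ω μ Ω),
      Integrable u.fn (μ.restrict Ω) := fun u =>
    (u.memLp.mono_measure hle).integrable (ENNReal.one_le_ofReal.2 hθ1.le)
  simp only [← BorderlineTrace.traceAt_restrict_iff]
  exact BorderlineTrace.exists_traceOperator (M := M) (fun u => (hM u).1)
    (fun u => hfr.mono fun z hz v w hv hw =>
      hv.unique hD (hint u).1 (frontier_subset_closure hz) hw)
    (fun u => (hint u).1)
    (fun u T hT => ⟨BorderlineTrace.aestronglyMeasurable_of_traceAt hD hfrK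
      frontier_subset_closure hfr (hint u) hT, (hM u).2 T hT⟩)
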